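/- **Setting.** Let $\mathcal X$ be a measurable space, $\mathcal D$ a probability distribution on $\mathcal X$, and let queries be measurable functions $q:\mathcal X\to[0,1]$, taken from a class parametrised by a measurable space so that $(q,x)\mapsto q(x)$ is jointly measurable. Write $\mathbb E[q]=\mathbb E_{x\sim\mathcal D}[q(x)]$ and $\mathcal E_S[q]=\frac1{|S|}\sum_{x\in S}q(x)$ for a finite dataset $S$. $\mathrm{Lap}(b)$ is the distribution on $\mathbb R$ with density $\frac1{2b}e^{-|x|/b}$. *Thresholdout* with datasets $S,T$ and parameters $\zeta,B,\sigma$ first draws $\rho\sim\mathrm{Lap}(2\sigma)$. On each query $q$: if $B<1$ it halts. Otherwise it draws $\lambda\sim\mathrm{Lap}(4\sigma)$; if $|\mathcal E_S[q]-\mathcal E_T[q]|>\zeta+\rho+\lambda$, it draws $\xi\sim\mathrm{Lap}(\sigma)$ and a new $\rho\sim\mathrm{Lap}(2\sigma)$, replaces $B$ by $B-1$ and outputs $(\mathcal E_T[q]+\xi,\top)$; if not, it outputs $(\mathcal E_S[q],\bot)$. All draws are independent. An *analyst with access to $S$* is a sequence of querying rules: the $i$-th query $q_i$ is drawn from a distribution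 that is an arbitrary (measurable) function of $S$ and of all earlier queries and replies. The query $q_i$ is *non-adaptive* if its rule is a fixed distribution over queries, which depends neither on $S$ nor on the history; otherwise it is *adaptive*. **Theorem.** There are universal constants $C_1,C_2>0$ such that the following holds for all $\mathcal X$, $\mathcal D$ and every class of queries. Let $\beta,\tau>0$ be real, $m$ a natural number, $B$ real with $m\ge B>0$, put $\zeta=\frac{3\tau}{4}$, $\sigma=\frac{\tau}{48\ln(4m/\beta)}$ and $\tau_0=\min\{\tau,1\}$, and let $$n\ \ge\ \min\left\{C_1\,\frac{B\ln(4m/\beta)}{\tau^2},\ \ C_2\,\frac{\ln(4m/\beta)\sqrt{B\ln\!\left(\frac{\ln(4/\tau_0)}{\beta\tau_0}\right)}}{\tau^2}\right\}.$$ Let $S,T$ be independent datasets of $n$ i.i.d. samples from $\mathcal D$, and let any analyst with access to $S$ ask $q_1,\dots,q_m$ of Thresholdout, run on $S,T$ with parameters $\zeta,B,\sigma$. Then with probability at least $1-\beta$, for all $i\in\{1,\dots,m\}$ that are answered before Thresholdout halts, the answer $(a_i,o_i)$ satisfies $|a_i-\mathbb E[q_i]|\le\tau$, and if $o_i=\top$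 then $q_i$ is an adaptive query. (For $\beta\ge1$ the claim is void.) -/

import Mathlib

open MeasureTheory ProbabilityTheory

universe u v

noncomputable section

namespace Thresholdout

/-- The Laplace distribution with mean `0` and scale `b` (meaningful for `0 < b`): the law on `ℝ`
with density `x ↦ exp (-|x| / b) / (2 b)`. -/
def laplace (b : ℝ) : Measure ℝ :=
  volume.withDensity fun x => ENNReal.ofReal (Real.exp (-|x| / b) / (2 * b))

/-- The empirical mean of `f` on the dataset `S`. -/
def empMean {X : Type u} {n : ℕ} (S : Fin n → X) (f : X → ℝ) : ℝ :=
  (∑ j, f (S j)) / n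

/-- What the mechanism returns on a query: `Sum.inl (a, o)` is the answer `a` together with the flag
`o` (`true` stands for `⊤` and `false` for `⊥`), and `Sum.inr ()` is HALT. -/
abbrev Reply : Type := (ℝ × Bool) ⊕ Unit

/-- The variables of the mechanism: the remaining budget `B` and the current value of `ρ`. -/
abbrev State : Type := ℝ × ℝ

/-- The fresh randomness for one query: values of `λ` and `ξ`, and a new value of `ρ`
(the last two are used only when the query is flagged). -/
abbrev Noise : Type := ℝ × ℝ × ℝ

/-- Independent `λ ∼ Lap(4σ)`, `ξ ∼ Lap(σ)` and `ρ ∼ Lap(2σ)`. -/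
def noiseLaw (σ : ℝ) : Measure Noise :=
  (laplace (4 * σ)).prod ((laplace σ).prod (laplace (2 * σ)))

/-- The body of the loop of Thresholdout, on a query with empirical means `eS` on `S` and `eT`
on `T`: the reply, and the new values of the variables `(B, ρ)`. -/
def respond (ζ eS eT : ℝ) : State → Noise → Reply × State
  | (b, r), (l, x, r') =>
    if b < 1 then (Sum.inr (), (b, r))
    else if ζ + r + l < |eS - eT| then (Sum.inl (eT + x, true), (b - 1, r'))
    else (Sum.inl (eS, false), (b, r))

/-- The record of the first `i` rounds: queries and replies. Queries are named by elements of `Θ`. -/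
abbrev History (Θ : Type v) (i : ℕ) : Type v := Fin i → Θ × Reply

/-- An analyst who holds the dataset `S`: a sequence of querying rules. The `i`-th rule
(counting from `0`) is a randomized map that takes `S` and all earlier queries and replies to
the next query. -/
structure Analyst (X : Type u) (Θ : Type v) [MeasurableSpace X] [MeasurableSpace Θ] (n : ℕ) where
  rule : (i : ℕ) → Kernel ((Fin n → X) × History Θ i) Θ
  markov : ∀ i, IsMarkovKernel (rule i)

variable {X : Type u} {Θ : Type v} [MeasurableSpace X] [MeasurableSpace Θ] {n : ℕ}

/-- The `i`-th query is non-adaptive: its rule is a fixed distribution over queries, whatever the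
dataset `S` and the history are. -/
def Analyst.IsNonadaptive (A : Analyst X Θ n) (i : ℕ) : Prop :=
  ∃ ν : Measure Θ, A.rule i = Kernel.const _ ν

/-- The `i`-th query is adaptive. -/
def Analyst.IsAdaptive (A : Analyst X Θ n) (i : ℕ) : Prop :=
  ¬ A.IsNonadaptive i

/-- The two datasets `(S, T)`. -/
abbrev Data (X : Type u) (n : ℕ) : Type u := (Fin n → X) × (Fin n → X)

/-- The situation after `i` rounds: the variables of the mechanism and the history. -/
abbrev Config (Θ : Type v) (i : ℕ) : Type v := State × History Θ i

/-- One round, once the query `θ` and the noise `z` have been drawn: the mechanism replies, and the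
query and the reply are appended to the history. -/
def advance (q : Θ → X → ℝ) (ζ : ℝ) (i : ℕ) :
    ((Data X n × Config Θ i) × Θ) × Noise → Config Θ (i + 1)
  | ((((S, T), (s, h)), θ), z) =>
    let out := respond ζ (empMean S (q θ)) (empMean T (q θ)) s z
    (out.2, Fin.snoc (α := fun _ => Θ × Reply) h (θ, out.1))

/-- The law of the query in round `i`, given the datasets and the situation so far: the rule sees
`S` and the history, but not `T` and not the variables of the mechanism. -/
def queryKernel (A : Analyst X Θ n) (i : ℕ) : Kernel (Data X n × Config Θ i) Θ :=
  (A.rule i).comap (fun p => (p.1.1, p.2.2)) (by fun_prop)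

/-- One round: draw the query, draw fresh noise independently, and let the mechanism reply. -/
def stepKernel (q : Θ → X → ℝ) (ζ σ : ℝ) (A : Analyst X Θ n) (i : ℕ) :
    Kernel (Data X n × Config Θ i) (Config Θ (i + 1)) :=
  ((Kernel.id ×ₖ queryKernel A i) ×ₖ Kernel.const _ (noiseLaw σ)).map (advance q ζ i)

/-- The law of the situation after `i` rounds of the interaction of the analyst with Thresholdout
(with parameters `ζ, B, σ`) as a function of the datasets. At the start, `ρ ∼ Lap(2σ)`. -/
def run (q : Θ → X → ℝ) (ζ B σ : ℝ) (A : Analyst X Θ n) :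
    (i : ℕ) → Kernel (Data X n) (Config Θ i)
  | 0 => Kernel.const _ (((Measure.dirac B).prod (laplace (2 * σ))).prod (Measure.dirac Fin.elim0))
  | i + 1 => (run q ζ B σ A i ⊗ₖ stepKernel q ζ σ A i).snd

/-- The joint law of the datasets, each drawn i.i.d. from `D`, and of the situation after `m` rounds
of the interaction. -/
def law (D : Measure X) (q : Θ → X → ℝ) (ζ B σ : ℝ) (A : Analyst X Θ n) (m : ℕ) :
    Measure (Data X n × Config Θ m) :=
  ((Measure.pi fun _ : Fin n => D).prod (Measure.pi fun _ : Fin n => D)) ⊗ₘ run q ζ B σ A m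

/-- The good event: every round `i` that is answered, with answer `a` and flag `o`, has
`|a - 𝔼 q_i| ≤ τ`, and the query is adaptive if it is flagged. -/
def goodEvent (D : Measure X) (q : Θ → X → ℝ) (τ : ℝ) (A : Analyst X Θ n) (m : ℕ) :
    Set (Data X n × Config Θ m) :=
  {w | ∀ (i : Fin m) (a : ℝ) (o : Bool), (w.2.2 i).2 = Sum.inl (a, o) →
    |a - ∫ x, q (w.2.2 i).1 x ∂D| ≤ τ ∧ (o = true → A.IsAdaptive i)}

end Thresholdout

end

open Thresholdout

namespace Thresholdout

open scoped ENNReal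

/-! Every answer is close to the empirical mean on `T`: a flagged one is that mean plus `ξ`, and an
unflagged one is the mean on `S` after it passed the comparison with `T`. If the noise stays within
its allowance of `6τ/48`, the distance is at most `ζ + τ/8 = 7τ/8`, so an answer with error above
`τ` exposes a query whose mean on `T` is off by more than `τ/8`. `S` may be overfitted at will; what
has to be shown is that the replies depend on `T` too weakly for such a query to be found.

Stability. The rounds up to the next flag form an epoch, an instance of the sparse vector technique.
A change of the means on `T` by `Δ = 1/n` is compensated by a shift of `ρ`, so unflagged rounds are
free, and an epoch is `2Δ/σ`-differentially private (`epochMean_le_mul`). At most `⌊B⌋` epochs are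
composed. Multiplying their factors gives the first sample size. For the second, with `η = exp(2Δ/σ)
- 1`, privacy of an epoch is converted into `E_T[G^(1/s)] ≤ (1 + O(η²/(s-1))) E_T'[G]^(1/s)` for `s`
near 1 (`epochMean_rpow_le`). The loss is of second order in `η`, and the bound composes with a
fixed exponent (`budgetVal_le_rpow`); this plays the role of Rényi divergence in advanced
composition.

Generalization. The score of the first bad round is one function `X → [0,1]` selected by the
interaction, so no union bound over rounds is needed. Since a point of `T` and a fresh point are
exchangeable, stability bounds the mean score on `T` by `C u^a`, where `u` is the mean score on a
fresh point (`lintegral_score_sample_le`). On a bad record the score on `T` exceeds the population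
score by `τ/8`, up to noise. With `p` the probability of a bad record this gives `u + (τ/8) p ≤ C
u^a + N`, and `u ≤ p` then forces `p = O(β)` (`mul_le_of_moment_bound`).

Noise enters through `N`, the mean of the largest excess over the allowances, and not through
conditioning, which would disturb the independence on which privacy rests.

Flags. A non-adaptive query is independent of both datasets, so by Hoeffding its two empirical means
are close, and a flag again requires a large noise excess. -/

/-! ### The Laplace distribution: mass, mean excess, translation. -/

lemma lintegral_laplace (b : ℝ) {f : ℝ → ℝ≥0∞} (hf : Measurable f) :
    ∫⁻ x, f x ∂laplace b = ∫⁻ x, ENNReal.ofReal (Real.exp (-|x| / b) / (2 * b)) * f x := by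
  rw [laplace, lintegral_withDensity_eq_lintegral_mul _ (by fun_prop) hf]
  rfl

lemma lintegral_Ioi_exp_neg_div {b : ℝ} (hb : 0 < b) :
    ∫⁻ x in Set.Ioi (0 : ℝ), ENNReal.ofReal (Real.exp (-x / b)) = ENNReal.ofReal b := by
  have key := Real.integral_rpow_mul_exp_neg_mul_Ioi (a := 1) one_pos (inv_pos.2 hb)
  simp only [sub_self, Real.rpow_zero, one_mul, Real.Gamma_one, mul_one, one_div, inv_inv,
    Real.rpow_one] at key
  have hrw : ∀ x : ℝ, Real.exp (-(b⁻¹ * x)) = Real.exp (-x / b) := fun x => by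
    congr 1; field_simp
  simp only [hrw] at key
  -- Integrability is read off from the value: the Bochner integral of a non-integrable function is
  -- zero by default.
  rw [← ofReal_integral_eq_lintegral_ofReal (.of_integral_ne_zero (by rw [key]; exact hb.ne'))
    (ae_of_all _ fun x => (Real.exp_pos _).le), key]

lemma lintegral_Ioi_mul_exp_neg_div {b : ℝ} (hb : 0 < b) :
    ∫⁻ x in Set.Ioi (0 : ℝ), ENNReal.ofReal (x * Real.exp (-x / b)) = ENNReal.ofReal (b ^ 2) := by
  have key := Real.integral_rpow_mul_exp_neg_mul_Ioi (a := 2) two_pos (inv_pos.2 hb)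
  have h2 : (2 : ℝ) - 1 = 1 := by norm_num
  simp only [h2, Real.rpow_one, one_div, inv_inv, Real.Gamma_two, mul_one, Real.rpow_two] at key
  have hrw : ∀ x : ℝ, Real.exp (-(b⁻¹ * x)) = Real.exp (-x / b) := fun x => by
    congr 1; field_simp
  simp only [hrw] at key
  rw [← ofReal_integral_eq_lintegral_ofReal
    (.of_integral_ne_zero (by rw [key]; exact (pow_pos hb 2).ne')) _, key]
  filter_upwards [ae_restrict_mem measurableSet_Ioi] with x hx
  exact mul_nonneg (le_of_lt hx) (Real.exp_pos _).le

/-- The mean excess of `|x|` over `t` under the Laplace distribution. -/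
lemma lintegral_laplace_excess {b : ℝ} (t : ℝ) (hb : 0 < b) :
    ∫⁻ x, ENNReal.ofReal (|x| - t) ∂laplace b ≤ ENNReal.ofReal (b * Real.exp (-t / b)) := by
  rw [lintegral_laplace b (by fun_prop)]
  set g : ℝ → ℝ≥0∞ := (Set.Ioi (0 : ℝ)).indicator
    fun y => ENNReal.ofReal (y * Real.exp (-y / b)) with hg
  set c := ENNReal.ofReal (Real.exp (-t / b) / (2 * b)) with hc
  have hgm : Measurable g := Measurable.indicator (by fun_prop) measurableSet_Ioi
  -- Each sign of `x` is covered by one translated copy of `y * exp (-y / b)` on the positive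
  -- half-line. For `t < 0` the copies overlap, which is harmless for an upper bound.
  have hle : ∀ x : ℝ, ENNReal.ofReal (Real.exp (-|x| / b) / (2 * b)) * ENNReal.ofReal (|x| - t)
      ≤ c * g (x + -t) + c * g (-x + -t) := by
    have aux : ∀ y : ℝ, ENNReal.ofReal (Real.exp (-y / b) / (2 * b)) * ENNReal.ofReal (y - t)
        ≤ c * g (y + -t) := by
      intro y
      rcases le_or_gt y t with h | h
      · simp [ENNReal.ofReal_of_nonpos (sub_nonpos.2 h)]
      · rw [hg, Set.indicator_of_mem (by simpa using h), hc,
          ← ENNReal.ofReal_mul (by positivity), ← ENNReal.ofReal_mul (by positivity)]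
        refine ENNReal.ofReal_le_ofReal (le_of_eq ?_)
        have : Real.exp (-y / b) = Real.exp (-t / b) * Real.exp (-(y + -t) / b) := by
          rw [← Real.exp_add]; congr 1; field_simp; ring
        rw [this]; ring
    intro x
    rcases abs_cases x with ⟨h, _⟩ | ⟨h, _⟩
    · rw [h]; exact (aux x).trans le_self_add
    · rw [h]; exact (aux (-x)).trans le_add_self
  have hgi : ∫⁻ x, g x = ENNReal.ofReal (b ^ 2) := by
    rw [hg, lintegral_indicator measurableSet_Ioi, lintegral_Ioi_mul_exp_neg_div hb]
  refine (lintegral_mono hle).trans ?_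
  rw [lintegral_add_left (by fun_prop), lintegral_const_mul _ (by fun_prop),
    lintegral_const_mul _ (by fun_prop), lintegral_add_right_eq_self g (-t)]
  have h2 : ∫⁻ x : ℝ, g (-x + -t) = ∫⁻ x, g x := by
    rw [lintegral_neg_eq_self (fun x : ℝ => g (x + -t)), lintegral_add_right_eq_self g (-t)]
  rw [h2, hgi, hc, ← ENNReal.ofReal_mul (by positivity),
    ← ENNReal.ofReal_add (by positivity) (by positivity)]
  refine ENNReal.ofReal_le_ofReal (le_of_eq ?_)
  field_simp; ring

lemma isProbabilityMeasure_laplace {b : ℝ} (hb : 0 < b) : IsProbabilityMeasure (laplace b) := by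
  refine ⟨?_⟩
  have h1 : laplace b Set.univ = ∫⁻ x : ℝ, ENNReal.ofReal (Real.exp (-|x| / b) / (2 * b)) := by
    rw [laplace, withDensity_apply _ MeasurableSet.univ, Measure.restrict_univ]
  have hint : ∫⁻ x in Set.Ioi (0 : ℝ), ENNReal.ofReal (Real.exp (-|x| / b) / (2 * b))
      = ENNReal.ofReal (1 / 2) := by
    have : ∀ x ∈ Set.Ioi (0 : ℝ), ENNReal.ofReal (Real.exp (-|x| / b) / (2 * b))
        = ENNReal.ofReal (1 / (2 * b)) * ENNReal.ofReal (Real.exp (-x / b)) := by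
      intro x hx
      rw [abs_of_pos hx, ← ENNReal.ofReal_mul (by positivity)]
      congr 1; ring
    rw [setLIntegral_congr_fun measurableSet_Ioi this, lintegral_const_mul _ (by fun_prop),
      lintegral_Ioi_exp_neg_div hb, ← ENNReal.ofReal_mul (by positivity)]
    congr 1; field_simp
  have hint2 : ∫⁻ x in Set.Iic (0 : ℝ), ENNReal.ofReal (Real.exp (-|x| / b) / (2 * b))
      = ENNReal.ofReal (1 / 2) := by
    rw [← hint, ← setLIntegral_congr (Iio_ae_eq_Iic (μ := volume) (a := (0 : ℝ))),
      ← lintegral_indicator measurableSet_Iio, ← lintegral_indicator measurableSet_Ioi,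
      ← lintegral_neg_eq_self]
    refine lintegral_congr fun x => ?_
    simp [Set.indicator_apply]
  rw [h1, ← lintegral_add_compl _ (measurableSet_Ioi (a := (0 : ℝ))), Set.compl_Ioi, hint, hint2,
    ← ENNReal.ofReal_add (by norm_num) (by norm_num)]
  norm_num

/-- Translating a Laplace variable changes probabilities by a bounded factor. -/
lemma lintegral_laplace_le_shift {b d e : ℝ} (hb : 0 < b) (hd : |d| ≤ e) {f : ℝ → ℝ≥0∞}
    (hf : Measurable f) :
    ∫⁻ x, f x ∂laplace b ≤ ENNReal.ofReal (Real.exp (e / b)) * ∫⁻ x, f (x + d) ∂laplace b := by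
  rw [lintegral_laplace b hf, lintegral_laplace b (by fun_prop),
    ← lintegral_const_mul _ (by fun_prop),
    ← lintegral_add_right_eq_self
      (fun x => ENNReal.ofReal (Real.exp (-|x| / b) / (2 * b)) * f x) d]
  refine lintegral_mono fun x => ?_
  rw [← mul_assoc, ← ENNReal.ofReal_mul (by positivity)]
  gcongr
  rw [← mul_div_assoc, ← Real.exp_add, ← add_div]
  gcongr
  have := abs_sub_abs_le_abs_sub x (x + d)
  have h2 : |x - (x + d)| = |d| := by rw [← abs_neg]; congr 1; ring
  linarith

lemma laplace_le_shift {b d e : ℝ} (hb : 0 < b) (hd : |d| ≤ e) {s : Set ℝ} (hs : MeasurableSet s) :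
    laplace b s ≤ ENNReal.ofReal (Real.exp (e / b)) * laplace b ((· + d) ⁻¹' s) := by
  have h := lintegral_laplace_le_shift hb hd (measurable_one.indicator hs)
  rw [lintegral_indicator_one hs] at h
  refine h.trans_eq ?_
  rw [← lintegral_indicator_one (hs.preimage (measurable_add_const d))]
  rfl

/-! ### Young's inequality with a quantitative gap. -/

/-- The slack in `x ≤ x^s/s + (1 - 1/s)` is at least of Hellinger type. It comes from `x^(s-1) ≥ 1 +
(s-1) log x` and `log x ≥ 2 (1 - 1/√x)`. -/
lemma rpow_young_gap {s x : ℝ} (hs : 1 < s) (hx : 0 ≤ x) :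
    x + (s - 1) / s * (√x - 1) ^ 2 ≤ x ^ s / s + (1 - 1 / s) := by
  have hs0 : 0 < s := by linarith
  have key : x + (s - 1) * (2 * x - 2 * √x) ≤ x ^ s := by
    rcases hx.eq_or_lt with rfl | hx
    · simp [Real.zero_rpow hs0.ne']
    have h1 : 1 + (s - 1) * Real.log x ≤ x ^ (s - 1) := by
      rw [Real.rpow_def_of_pos hx, add_comm, mul_comm]; exact Real.add_one_le_exp _
    have h2 : 1 - (√x)⁻¹ ≤ Real.log √x := Real.one_sub_inv_le_log_of_pos (Real.sqrt_pos.2 hx)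
    rw [Real.log_sqrt hx.le] at h2
    have h3 : x * (√x)⁻¹ = √x := by
      rw [← div_eq_mul_inv, Real.div_sqrt]
    have h4 : x ^ s = x * x ^ (s - 1) := by
      rw [← Real.rpow_one_add' hx.le (by linarith)]; congr 1; ring
    have h5 : 2 * x - 2 * √x ≤ x * Real.log x := by
      have := mul_le_mul_of_nonneg_left h2 hx.le
      rw [mul_sub, h3] at this
      linarith
    have h6 := mul_le_mul_of_nonneg_left h1 hx.le
    have h7 := mul_le_mul_of_nonneg_left h5 (sub_pos.2 hs).le
    rw [h4]
    nlinarith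
  have hsq : √x ^ 2 = x := Real.sq_sqrt hx
  have : x ^ s / s + (1 - 1 / s) - (x + (s - 1) / s * (√x - 1) ^ 2)
      = (x ^ s - (x + (s - 1) * (2 * x - 2 * √x))) / s := by
    rw [sub_sq, hsq]; field_simp; ring
  have h8 := div_nonneg (sub_nonneg.2 key) hs0.le
  linarith

/-- Both sides of Young's inequality are tangent at `x = 1`, so the quadratic gap there turns a
perturbation linear in `η` into a factor that is quadratic in `η`. The gap is `2k (√x - 1)²` with `k
= (s-1)/(2s)`: one half absorbs the perturbation by AM-GM, the other half is kept for small `x`. -/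
lemma add_mul_abs_sub_one_le {s x η : ℝ} (hs : 1 < s) (hx : 0 ≤ x) (hη : 0 ≤ η)
    (hk : η ≤ (s - 1) / (2 * s)) :
    x + η * |x - 1| ≤ (1 + 17 * s * η ^ 2 / (s - 1)) * (x ^ s / s + (1 - 1 / s)) := by
  have hs1 : 0 < s - 1 := by linarith
  have hs0 : 0 < s := by linarith
  set k := (s - 1) / (2 * s) with hkdef
  have hk0 : 0 < k := by positivity
  have hkk : (s - 1) / s = 2 * k := by rw [hkdef]; field_simp
  have hc : 17 * s * η ^ 2 / (s - 1) = 17 * η ^ 2 / (2 * k) := by rw [hkdef]; field_simp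
  have gap := rpow_young_gap hs hx
  rw [hkk] at gap
  rw [hc]
  set Ψ := x ^ s / s + (1 - 1 / s)
  set y := √x with hy
  have hy0 : 0 ≤ y := Real.sqrt_nonneg x
  have hxy : x = y ^ 2 := (Real.sq_sqrt hx).symm
  have hc0 : 0 ≤ 17 * η ^ 2 / (2 * k) := by positivity
  have hΨ : x ≤ Ψ := by nlinarith [sq_nonneg (y - 1)]
  have habs : |x - 1| = |y - 1| * (y + 1) := by
    have : x - 1 = (y - 1) * (y + 1) := by rw [hxy]; ring
    rw [this, abs_mul, abs_of_nonneg (by linarith : 0 ≤ y + 1)]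
  have hT : η * |x - 1| ≤ k * (y - 1) ^ 2 + η ^ 2 * (1 + x) / (2 * k) := by
    have h1 : k * (y - 1) ^ 2 + η ^ 2 * (y + 1) ^ 2 / (4 * k) - η * (|y - 1| * (y + 1))
        = (2 * k * |y - 1| - η * (y + 1)) ^ 2 / (4 * k) := by
      rw [← sq_abs (y - 1)]; field_simp; ring
    have h2 : η ^ 2 * (y + 1) ^ 2 / (4 * k) ≤ η ^ 2 * (1 + x) / (2 * k) := by
      rw [div_le_div_iff₀ (by positivity) (by positivity), hxy]
      nlinarith [mul_nonneg (mul_nonneg (sq_nonneg η) hk0.le) (sq_nonneg (y - 1))]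
    have h3 : 0 ≤ (2 * k * |y - 1| - η * (y + 1)) ^ 2 / (4 * k) := by positivity
    rw [habs]; linarith
  -- Above `1/16` one has `1 + x ≤ 17 x`, the source of the constant 17. Below it `(√x - 1)² ≥
  -- 9/16`, and as `η ≤ k` the second half of the gap absorbs everything.
  have hS : η ^ 2 * (1 + x) / (2 * k) ≤ k * (y - 1) ^ 2 + 17 * η ^ 2 / (2 * k) * x := by
    rcases le_or_gt (1 / 16) x with h | h
    · have : η ^ 2 * (1 + x) / (2 * k) ≤ 17 * η ^ 2 / (2 * k) * x := by
        rw [div_mul_eq_mul_div]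
        gcongr ?_ / _
        nlinarith [sq_nonneg η]
      have := mul_nonneg hk0.le (sq_nonneg (y - 1))
      linarith
    · have hy4 : y < 1 / 4 := by nlinarith
      have h1 : η ^ 2 * (1 + x) / (2 * k) ≤ k * (y - 1) ^ 2 := by
        rw [div_le_iff₀ (by positivity)]
        have : η ^ 2 ≤ k ^ 2 := by gcongr
        have h9 : 9 / 16 ≤ (y - 1) ^ 2 := by nlinarith
        nlinarith [sq_nonneg k, sq_nonneg η]
      have : 0 ≤ 17 * η ^ 2 / (2 * k) * x := by positivity
      linarith
  have := mul_le_mul_of_nonneg_left hΨ hc0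
  linarith

/-- The scalar inequality at `X^(1/s) / w`, multiplied by `w`; one of the two truncated differences
vanishes and the other is `|X^(1/s) - w|`. The right side is affine in `X`, so it can be averaged
over an epoch. -/
lemma young_excess_le {s η w : ℝ} (hs : 1 < s) (hη : 0 ≤ η) (hk : η ≤ (s - 1) / (2 * s))
    (hw : 0 < w) {X : ℝ≥0∞} (hX : X ≤ 1) :
    X ^ s⁻¹ + ENNReal.ofReal η * (X ^ s⁻¹ - ENNReal.ofReal w)
        + ENNReal.ofReal η * (ENNReal.ofReal w - X ^ s⁻¹)
      ≤ ENNReal.ofReal ((1 + 17 * s * η ^ 2 / (s - 1)) * (w ^ (1 - s) / s)) * X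
        + ENNReal.ofReal ((1 + 17 * s * η ^ 2 / (s - 1)) * ((1 - 1 / s) * w)) := by
  have hs0 : 0 < s := by linarith
  have hs1 : 0 < s - 1 := by linarith
  obtain ⟨y, hy0, rfl⟩ : ∃ y : ℝ, 0 ≤ y ∧ X = ENNReal.ofReal y :=
    ⟨X.toReal, ENNReal.toReal_nonneg,
      (ENNReal.ofReal_toReal (hX.trans_lt ENNReal.one_lt_top).ne).symm⟩
  rw [ENNReal.ofReal_rpow_of_nonneg hy0 (inv_nonneg.2 hs0.le)]
  set x := y ^ s⁻¹ with hx
  have hx0 : 0 ≤ x := Real.rpow_nonneg hy0 _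
  have hyx : y = x ^ s := by rw [hx, ← Real.rpow_mul hy0, inv_mul_cancel₀ hs0.ne', Real.rpow_one]
  have hinv : 1 / s ≤ 1 := by rw [div_le_one hs0]; exact hs.le
  have hC : 0 ≤ 1 + 17 * s * η ^ 2 / (s - 1) := by positivity
  have hCw : 0 ≤ (1 + 17 * s * η ^ 2 / (s - 1)) * ((1 - 1 / s) * w) :=
    mul_nonneg hC (mul_nonneg (by linarith) hw.le)
  rw [← ENNReal.ofReal_sub _ hw.le, ← ENNReal.ofReal_sub _ hx0, ← ENNReal.ofReal_mul hη,
    ← ENNReal.ofReal_mul hη, ← ENNReal.ofReal_mul (by positivity),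
    ← ENNReal.ofReal_add (by positivity) hCw]
  have key := add_mul_abs_sub_one_le hs (div_nonneg hx0 hw.le) hη hk
  have hkey : x + η * |x - w| ≤ (1 + 17 * s * η ^ 2 / (s - 1)) * (w ^ (1 - s) / s) * y
      + (1 + 17 * s * η ^ 2 / (s - 1)) * ((1 - 1 / s) * w) := by
    have h1 := mul_le_mul_of_nonneg_left key hw.le
    have h2 : w * (x / w + η * |x / w - 1|) = x + η * |x - w| := by
      have : x / w - 1 = (x - w) / w := by field_simp
      rw [this, abs_div, abs_of_pos hw]; field_simp
    have h3 : w * (x / w) ^ s = w ^ (1 - s) * y := by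
      rw [Real.div_rpow hx0 hw.le, ← hyx, Real.rpow_sub hw, Real.rpow_one]; ring
    rw [h2] at h1
    refine h1.trans (le_of_eq ?_)
    linear_combination (1 + 17 * s * η ^ 2 / (s - 1)) / s * h3
  rcases le_total x w with h | h
  · rw [ENNReal.ofReal_of_nonpos (mul_nonpos_of_nonneg_of_nonpos hη (sub_nonpos.2 h)), add_zero,
      ← ENNReal.ofReal_add hx0 (mul_nonneg hη (sub_nonneg.2 h))]
    refine ENNReal.ofReal_le_ofReal ?_
    rwa [abs_of_nonpos (sub_nonpos.2 h), neg_sub] at hkey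
  · rw [ENNReal.ofReal_of_nonpos (mul_nonpos_of_nonneg_of_nonpos hη (sub_nonpos.2 h)), add_zero,
      ← ENNReal.ofReal_add hx0 (mul_nonneg hη (sub_nonneg.2 h))]
    refine ENNReal.ofReal_le_ofReal ?_
    rwa [abs_of_nonneg (sub_nonneg.2 h)] at hkey

/-- A bound linear in `X` with every slope of Young's inequality is a bound by a power of `X`. -/
lemma le_rpow_of_forall_young {s C : ℝ} (hs : 1 < s) (hC : 0 ≤ C) {g X : ℝ≥0∞} (hX : X ≤ 1)
    (h : ∀ w : ℝ, 0 < w → g ≤ ENNReal.ofReal (C * (w ^ (1 - s) / s)) * X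
      + ENNReal.ofReal (C * ((1 - 1 / s) * w))) :
    g ≤ ENNReal.ofReal C * X ^ s⁻¹ := by
  have hs0 : 0 < s := by linarith
  rcases eq_or_ne X 0 with rfl | hX0
  · rw [ENNReal.zero_rpow_of_pos (inv_pos.2 hs0), mul_zero]
    simp only [mul_zero, zero_add] at h
    have hlim : Filter.Tendsto (fun w : ℝ => ENNReal.ofReal (C * ((1 - 1 / s) * w)))
        (nhdsWithin 0 (Set.Ioi 0)) (nhds 0) := by
      have : Filter.Tendsto (fun w : ℝ => ENNReal.ofReal (C * ((1 - 1 / s) * w)))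
          (nhds 0) (nhds (ENNReal.ofReal (C * ((1 - 1 / s) * 0)))) :=
        (ENNReal.continuous_ofReal.comp (by fun_prop)).tendsto 0
      simp only [mul_zero, ENNReal.ofReal_zero] at this
      exact this.mono_left nhdsWithin_le_nhds
    exact ge_of_tendsto hlim (by filter_upwards [self_mem_nhdsWithin] with w hw using h w hw)
  · obtain ⟨y, hy0, rfl⟩ : ∃ y : ℝ, 0 ≤ y ∧ X = ENNReal.ofReal y :=
      ⟨X.toReal, ENNReal.toReal_nonneg,
        (ENNReal.ofReal_toReal (hX.trans_lt ENNReal.one_lt_top).ne).symm⟩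
    have hy : 0 < y := by simpa using hX0
    have hinv : 1 / s ≤ 1 := by rw [div_le_one hs0]; exact hs.le
    -- The point of tangency is the optimal `w`. For `X = 0` it would be zero, which is why that
    -- case was settled by a limit.
    refine (h (y ^ s⁻¹) (by positivity)).trans (le_of_eq ?_)
    rw [ENNReal.ofReal_rpow_of_pos hy, ← ENNReal.ofReal_mul (by positivity),
      ← ENNReal.ofReal_add (by positivity)
        (mul_nonneg hC (mul_nonneg (by linarith) (by positivity))), ← ENNReal.ofReal_mul hC]
    congr 1
    have : (y ^ s⁻¹) ^ (1 - s) * y = y ^ s⁻¹ := by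
      rw [← Real.rpow_mul hy.le]
      nth_rewrite 2 [← Real.rpow_one y]
      rw [← Real.rpow_add hy]
      congr 1; field_simp; ring
    linear_combination C / s * this

/-- Numerical core of the mean bound: two probability functionals that dominate one another up
to the factor `1 + η`. -/
lemma le_add_excess {η w gT pT nT g' p' n' : ℝ≥0∞} (h1 : gT + nT = w + pT)
    (h2 : g' + n' = w + p') (hp : pT ≤ (1 + η) * p') (hn : n' ≤ (1 + η) * nT) (hη : η ≠ ∞)
    (hw : w ≠ ∞) (hg' : g' ≠ ∞) (hn' : n' ≠ ∞) (hnT : nT ≠ ∞) :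
    gT ≤ g' + η * p' + η * n' := by
  have hp' : p' ≠ ∞ := fun h => by
    rw [h, add_top] at h2; exact ENNReal.add_ne_top.2 ⟨hg', hn'⟩ h2
  have hpT : pT ≠ ∞ := (hp.trans_lt (by finiteness)).ne
  have hgT : gT ≠ ∞ := fun h => by
    rw [h, top_add] at h1; exact ENNReal.add_ne_top.2 ⟨hw, hpT⟩ h1.symm
  lift η to NNReal using hη
  lift w to NNReal using hw
  lift g' to NNReal using hg'
  lift n' to NNReal using hn'
  lift nT to NNReal using hnT
  lift p' to NNReal using hp'
  lift pT to NNReal using hpT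
  lift gT to NNReal using hgT
  norm_cast at h1 h2 hp hn ⊢
  rw [← NNReal.coe_le_coe] at hp hn ⊢
  rw [← NNReal.coe_inj] at h1 h2
  push_cast at *
  have h0 : (0 : ℝ) ≤ η := η.2
  have h3 : (0 : ℝ) ≤ nT := nT.2
  have h4 : (0 : ℝ) ≤ n' := n'.2
  -- The level `w` cancels between the two balance equations, so only the parts of `g` above and
  -- below `w` pay the factor. The loss below `w` is charged to `n'`, which leaves only the second
  -- functional in the bound.
  have h5 : (n' : ℝ) - nT ≤ η * n' := by
    rcases le_total (nT : ℝ) n' with h | h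
    · nlinarith
    · nlinarith [mul_nonneg h0 h4]
  linarith

/-! ### The interaction as a backward recursion; privacy of one epoch and composition of epochs. -/

section Epoch

variable {Θ : Type v} [MeasurableSpace Θ]

lemma measurable_snoc (i : ℕ) : Measurable fun p : History Θ i × (Θ × Reply) =>
    (Fin.snoc (α := fun _ => Θ × Reply) p.1 p.2 : History Θ (i + 1)) := by
  refine measurable_pi_iff.2 fun j => ?_
  refine Fin.lastCases ?_ (fun j => ?_) j
  · simpa using measurable_snd
  · simp only [Fin.snoc_castSucc]
    exact (measurable_pi_apply j).comp measurable_fst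

/-- The record `h`, extended by one round. -/
abbrev extend {i : ℕ} (h : History Θ i) (e : Θ × Reply) : History Θ (i + 1) :=
  Fin.snoc (α := fun _ => Θ × Reply) h e

lemma Measurable.extend {α : Type*} [MeasurableSpace α] {i : ℕ} {f : α → History Θ i}
    {g : α → Θ × Reply} (hf : Measurable f) (hg : Measurable g) :
    Measurable fun a => extend (f a) (g a) :=
  (measurable_snoc i).comp (hf.prodMk hg)

/-- The mean of `G` at the end of the current epoch, which lasts until the first flag: `j` rounds
are left, `h` is the record of the first `i` rounds, and `r` is the current value of `ρ`. The
first argument of `G` is the number of rounds that are left. -/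
noncomputable def epochVal (κ : ∀ i, Kernel (History Θ i) Θ) (ζ σ : ℝ) (eS eT : Θ → ℝ)
    (G : ℕ → ∀ i, History Θ i → ℝ≥0∞) : ℕ → ∀ i, ℝ → History Θ i → ℝ≥0∞
  | 0, i, _, h => G 0 i h
  | j + 1, i, r, h => ∫⁻ θ, (laplace (4 * σ) (Set.Iio (|eS θ - eT θ| - ζ - r)) *
        ∫⁻ x, G j (i + 1) (extend h (θ, Sum.inl (eT θ + x, true))) ∂laplace σ
      + laplace (4 * σ) (Set.Ici (|eS θ - eT θ| - ζ - r)) *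
        epochVal κ ζ σ eS eT G j (i + 1) r (extend h (θ, Sum.inl (eS θ, false)))) ∂κ i h

/-- The mean of `G` at the end of an epoch that starts now. -/
noncomputable def epochMean (κ : ∀ i, Kernel (History Θ i) Θ) (ζ σ : ℝ) (eS eT : Θ → ℝ)
    (G : ℕ → ∀ i, History Θ i → ℝ≥0∞) (j i : ℕ) (h : History Θ i) : ℝ≥0∞ :=
  ∫⁻ r, epochVal κ ζ σ eS eT G j i r h ∂laplace (2 * σ)

/-- The mean of `F` when Thresholdout has halted. -/
noncomputable def haltVal (κ : ∀ i, Kernel (History Θ i) Θ) (F : ∀ i, History Θ i → ℝ≥0∞) :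
    ℕ → ∀ i, History Θ i → ℝ≥0∞
  | 0, i, h => F i h
  | j + 1, i, h => ∫⁻ θ, haltVal κ F j (i + 1) (extend h (θ, Sum.inr ())) ∂κ i h

/-- The mean of `F` at the end of the interaction when `k` flags are still allowed and a new epoch
starts now. -/
noncomputable def budgetVal (κ : ∀ i, Kernel (History Θ i) Θ) (ζ σ : ℝ) (eS eT : Θ → ℝ)
    (F : ∀ i, History Θ i → ℝ≥0∞) : ℕ → ℕ → ∀ i, History Θ i → ℝ≥0∞
  | 0 => haltVal κ F
  | k + 1 => epochMean κ ζ σ eS eT (budgetVal κ ζ σ eS eT F k)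

lemma measurable_apply_Iio (μ : Measure ℝ) : Measurable fun t => μ (Set.Iio t) :=
  Monotone.measurable fun _ _ h => measure_mono (Set.Iio_subset_Iio h)

lemma measurable_apply_Ici (μ : Measure ℝ) : Measurable fun t => μ (Set.Ici t) :=
  Antitone.measurable fun _ _ h => measure_mono (Set.Ici_subset_Ici.2 h)

variable {κ : ∀ i, Kernel (History Θ i) Θ} [∀ i, IsMarkovKernel (κ i)] {ζ σ : ℝ}
  {eS eT eT' : Θ → ℝ} {F : ∀ i, History Θ i → ℝ≥0∞} {G G' : ℕ → ∀ i, History Θ i → ℝ≥0∞}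

lemma sFinite_laplace (b : ℝ) : SFinite (laplace b) := by unfold laplace; infer_instance

attribute [local instance] sFinite_laplace

lemma measurable_flagged (heT : Measurable eT) (hG : ∀ j i, Measurable (G j i)) (j i : ℕ) :
    Measurable fun p : History Θ i × Θ =>
      ∫⁻ x, G j (i + 1) (extend p.1 (p.2, Sum.inl (eT p.2 + x, true))) ∂laplace σ := by
  refine Measurable.lintegral_prod_right' (f := fun p : (History Θ i × Θ) × ℝ =>
    G j (i + 1) (extend p.1.1 (p.1.2, Sum.inl (eT p.1.2 + p.2, true)))) ?_
  refine (hG j (i + 1)).comp (Measurable.extend (by fun_prop) ?_)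
  exact (by fun_prop : Measurable _).prodMk (measurable_inl.comp (by fun_prop))

lemma measurable_epochVal (heS : Measurable eS) (heT : Measurable eT)
    (hG : ∀ j i, Measurable (G j i)) (j i : ℕ) :
    Measurable fun p : ℝ × History Θ i => epochVal κ ζ σ eS eT G j i p.1 p.2 := by
  induction j generalizing i with
  | zero => exact (hG 0 i).comp measurable_snd
  | succ j ih =>
    simp only [epochVal]
    refine Measurable.lintegral_kernel_prod_right' (κ := (κ i).comap Prod.snd measurable_snd)
      (f := fun p : (ℝ × History Θ i) × Θ =>
        laplace (4 * σ) (Set.Iio (|eS p.2 - eT p.2| - ζ - p.1.1)) *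
        ∫⁻ x, G j (i + 1) (extend p.1.2 (p.2, Sum.inl (eT p.2 + x, true))) ∂laplace σ
      + laplace (4 * σ) (Set.Ici (|eS p.2 - eT p.2| - ζ - p.1.1)) *
        epochVal κ ζ σ eS eT G j (i + 1) p.1.1 (extend p.1.2 (p.2, Sum.inl (eS p.2, false)))) ?_
    have hgap : Measurable fun p : (ℝ × History Θ i) × Θ => |eS p.2 - eT p.2| - ζ - p.1.1 := by
      have : Measurable fun p : (ℝ × History Θ i) × Θ => |eS p.2 - eT p.2| :=
        ((heS.comp measurable_snd).sub (heT.comp measurable_snd)).abs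
      fun_prop
    refine (((measurable_apply_Iio _).comp hgap).mul ?_).add
      (((measurable_apply_Ici _).comp hgap).mul ?_)
    · exact (measurable_flagged heT hG j i).comp
        ((measurable_snd.comp measurable_fst).prodMk measurable_snd)
    · refine (ih (i + 1)).comp ((measurable_fst.comp measurable_fst).prodMk
        (Measurable.extend (by fun_prop) ?_))
      exact measurable_snd.prodMk (measurable_inl.comp (by fun_prop))

lemma measurable_epochMean (heS : Measurable eS) (heT : Measurable eT)
    (hG : ∀ j i, Measurable (G j i)) (j i : ℕ) :
    Measurable (epochMean κ ζ σ eS eT G j i) :=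
  Measurable.lintegral_prod_left' (measurable_epochVal heS heT hG j i)

lemma measurable_haltVal (hF : ∀ i, Measurable (F i)) (j i : ℕ) :
    Measurable (haltVal κ F j i) := by
  induction j generalizing i with
  | zero => exact hF i
  | succ j ih =>
    refine Measurable.lintegral_kernel_prod_right' (κ := κ i)
      (f := fun p : History Θ i × Θ => haltVal κ F j (i + 1) (extend p.1 (p.2, Sum.inr ()))) ?_
    exact (ih (i + 1)).comp (Measurable.extend (by fun_prop) (by fun_prop))

lemma measurable_budgetVal (heS : Measurable eS) (heT : Measurable eT)
    (hF : ∀ i, Measurable (F i)) (k j i : ℕ) :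
    Measurable (budgetVal κ ζ σ eS eT F k j i) := by
  induction k generalizing j i with
  | zero => exact measurable_haltVal hF j i
  | succ k ih => exact measurable_epochMean heS heT ih j i

/-- The integrand of `epochVal` is measurable in the query. -/
lemma measurable_round (heS : Measurable eS) (heT : Measurable eT)
    (hG : ∀ j i, Measurable (G j i)) (j i : ℕ) (r : ℝ) (h : History Θ i) :
    Measurable (fun θ => laplace (4 * σ) (Set.Iio (|eS θ - eT θ| - ζ - r)) *
        ∫⁻ x, G j (i + 1) (extend h (θ, Sum.inl (eT θ + x, true))) ∂laplace σ) ∧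
    Measurable (fun θ => laplace (4 * σ) (Set.Ici (|eS θ - eT θ| - ζ - r)) *
        epochVal κ ζ σ eS eT G j (i + 1) r (extend h (θ, Sum.inl (eS θ, false)))) := by
  have hgap : Measurable fun θ => |eS θ - eT θ| - ζ - r := by
    have := (heS.sub heT).abs
    exact (this.sub_const ζ).sub_const r
  refine ⟨((measurable_apply_Iio _).comp hgap).mul ?_, ((measurable_apply_Ici _).comp hgap).mul ?_⟩
  · exact (measurable_flagged heT hG j i).comp measurable_prodMk_left
  · refine (measurable_epochVal heS heT hG j (i + 1)).comp
      (measurable_const.prodMk (Measurable.extend measurable_const ?_))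
    exact measurable_id.prodMk (measurable_inl.comp (by fun_prop))

lemma measurable_extend_flag (hG : ∀ j i, Measurable (G j i)) (j i : ℕ) (h : History Θ i) (θ : Θ)
    (a : ℝ) : Measurable fun x : ℝ => G j (i + 1) (extend h (θ, Sum.inl (a + x, true))) := by
  refine (hG j (i + 1)).comp (Measurable.extend measurable_const ?_)
  exact measurable_const.prodMk (measurable_inl.comp (by fun_prop))

omit [∀ i, IsMarkovKernel (κ i)] in
lemma epochVal_mono (hGG' : ∀ j i h, G j i h ≤ G' j i h) (j i : ℕ) (r : ℝ) (h : History Θ i) :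
    epochVal κ ζ σ eS eT G j i r h ≤ epochVal κ ζ σ eS eT G' j i r h := by
  induction j generalizing i with
  | zero => exact hGG' 0 i h
  | succ j ih =>
    simp only [epochVal]
    gcongr with θ x
    · exact hGG' _ _ _
    · exact ih _ _

lemma epochVal_add (heS : Measurable eS) (heT : Measurable eT) (hG : ∀ j i, Measurable (G j i))
    (j i : ℕ) (r : ℝ) (h : History Θ i) :
    epochVal κ ζ σ eS eT (fun j i h => G j i h + G' j i h) j i r h
      = epochVal κ ζ σ eS eT G j i r h + epochVal κ ζ σ eS eT G' j i r h := by
  induction j generalizing i with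
  | zero => rfl
  | succ j ih =>
    obtain ⟨h1, h2⟩ := measurable_round (κ := κ) (ζ := ζ) (σ := σ) heS heT hG j i r h
    simp only [epochVal]
    rw [← lintegral_add_left (by exact h1.add h2)]
    refine lintegral_congr fun θ => ?_
    rw [ih, lintegral_add_left (measurable_extend_flag hG j i h θ (eT θ))]
    ring

lemma epochVal_const_mul (heS : Measurable eS) (heT : Measurable eT)
    (hG : ∀ j i, Measurable (G j i)) (c : ℝ≥0∞) (j i : ℕ) (r : ℝ) (h : History Θ i) :
    epochVal κ ζ σ eS eT (fun j i h => c * G j i h) j i r h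
      = c * epochVal κ ζ σ eS eT G j i r h := by
  induction j generalizing i with
  | zero => rfl
  | succ j ih =>
    obtain ⟨h1, h2⟩ := measurable_round (κ := κ) (ζ := ζ) (σ := σ) heS heT hG j i r h
    simp only [epochVal]
    rw [← lintegral_const_mul _ (by exact h1.add h2)]
    refine lintegral_congr fun θ => ?_
    rw [ih, lintegral_const_mul _ (measurable_extend_flag hG j i h θ (eT θ))]
    ring

lemma epochVal_const (hσ : 0 < σ) (c : ℝ≥0∞) (j i : ℕ) (r : ℝ) (h : History Θ i) :
    epochVal κ ζ σ eS eT (fun _ _ _ => c) j i r h = c := by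
  have := isProbabilityMeasure_laplace hσ
  have := isProbabilityMeasure_laplace (by positivity : 0 < 4 * σ)
  induction j generalizing i with
  | zero => rfl
  | succ j ih =>
    simp only [epochVal, ih, lintegral_const, measure_univ, mul_one]
    have : ∀ t, laplace (4 * σ) (Set.Iio t) * c + laplace (4 * σ) (Set.Ici t) * c = c := by
      intro t
      rw [← add_mul, ← Set.compl_Iio, measure_add_measure_compl measurableSet_Iio, measure_univ,
        one_mul]
    simp [this]

omit [∀ i, IsMarkovKernel (κ i)] in
lemma epochMean_mono (hGG' : ∀ j i h, G j i h ≤ G' j i h) (j i : ℕ) (h : History Θ i) :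
    epochMean κ ζ σ eS eT G j i h ≤ epochMean κ ζ σ eS eT G' j i h :=
  lintegral_mono fun r => epochVal_mono hGG' j i r h

lemma measurable_epochVal_left (heS : Measurable eS) (heT : Measurable eT)
    (hG : ∀ j i, Measurable (G j i)) (j i : ℕ) (h : History Θ i) :
    Measurable fun r => epochVal κ ζ σ eS eT G j i r h :=
  (measurable_epochVal heS heT hG j i).comp measurable_prodMk_right

lemma epochMean_add (heS : Measurable eS) (heT : Measurable eT) (hG : ∀ j i, Measurable (G j i))
    (j i : ℕ) (h : History Θ i) :
    epochMean κ ζ σ eS eT (fun j i h => G j i h + G' j i h) j i h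
      = epochMean κ ζ σ eS eT G j i h + epochMean κ ζ σ eS eT G' j i h := by
  simp only [epochMean, epochVal_add heS heT hG]
  exact lintegral_add_left (measurable_epochVal_left heS heT hG j i h) _

lemma epochMean_const_mul (heS : Measurable eS) (heT : Measurable eT)
    (hG : ∀ j i, Measurable (G j i)) (c : ℝ≥0∞) (j i : ℕ) (h : History Θ i) :
    epochMean κ ζ σ eS eT (fun j i h => c * G j i h) j i h
      = c * epochMean κ ζ σ eS eT G j i h := by
  simp only [epochMean, epochVal_const_mul heS heT hG]
  exact lintegral_const_mul _ (measurable_epochVal_left heS heT hG j i h)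

lemma epochMean_const (hσ : 0 < σ) (c : ℝ≥0∞) (j i : ℕ) (h : History Θ i) :
    epochMean κ ζ σ eS eT (fun _ _ _ => c) j i h = c := by
  have := isProbabilityMeasure_laplace (by positivity : 0 < 2 * σ)
  simp [epochMean, epochVal_const hσ]

lemma epochMean_le (hσ : 0 < σ) {c : ℝ≥0∞} (hG : ∀ j i h, G j i h ≤ c) (j i : ℕ)
    (h : History Θ i) : epochMean κ ζ σ eS eT G j i h ≤ c :=
  (epochMean_mono hG j i h).trans_eq (epochMean_const hσ c j i h)

lemma haltVal_le {c : ℝ≥0∞} (hF : ∀ i h, F i h ≤ c) (j i : ℕ) (h : History Θ i) :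
    haltVal κ F j i h ≤ c := by
  induction j generalizing i with
  | zero => exact hF i h
  | succ j ih =>
    exact (lintegral_mono fun θ => ih _ _).trans_eq (by simp)

lemma budgetVal_le (hσ : 0 < σ) {c : ℝ≥0∞} (hF : ∀ i h, F i h ≤ c) (k j i : ℕ)
    (h : History Θ i) : budgetVal κ ζ σ eS eT F k j i h ≤ c := by
  induction k generalizing j i with
  | zero => exact haltVal_le hF j i h
  | succ k ih => exact epochMean_le hσ ih j i h

/-- Shifting `ρ` by `Δ` compensates a change of the empirical means on `T` by at most `Δ`. -/
lemma epochVal_le_shift (hσ : 0 < σ) {Δ : ℝ} (hΔ : ∀ θ, |eT θ - eT' θ| ≤ Δ)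
    (hG : ∀ j i, Measurable (G j i)) (j i : ℕ) (r : ℝ) (h : History Θ i) :
    epochVal κ ζ σ eS eT G j i r h
      ≤ ENNReal.ofReal (Real.exp (3 / 2 * (Δ / σ))) * epochVal κ ζ σ eS eT' G j i (r + Δ) h := by
  have hΔ0 : 0 ≤ Δ :=
    (abs_nonneg _).trans (hΔ (nonempty_of_isProbabilityMeasure (κ i h)).some)
  induction j generalizing i with
  | zero =>
    simp only [epochVal]
    exact le_mul_of_one_le_left' (by
      rw [ENNReal.one_le_ofReal, Real.one_le_exp_iff]; positivity)
  | succ j ih =>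
    simp only [epochVal]
    rw [← lintegral_const_mul' _ _ ENNReal.ofReal_ne_top]
    refine lintegral_mono fun θ => ?_
    rw [mul_add]
    have hgap : |eS θ - eT θ| ≤ |eS θ - eT' θ| + Δ := by
      have := abs_add_le (eS θ - eT' θ) (eT' θ - eT θ)
      have h2 := hΔ θ
      rw [abs_sub_comm] at h2
      rw [sub_add_sub_cancel] at this
      linarith
    have hgap' : |eS θ - eT' θ| ≤ |eS θ - eT θ| + Δ := by
      have := abs_add_le (eS θ - eT θ) (eT θ - eT' θ)
      rw [sub_add_sub_cancel] at this
      linarith [hΔ θ]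
    refine add_le_add ?_ ?_
    -- With a flag, gap and `ρ` each move by at most `Δ`, so `λ` is shifted by `2Δ` at scale `4σ`,
    -- at a price of `Δ/(2σ)`. Keeping the reply fixed shifts `ξ` at a price of `Δ/σ`. An epoch has
    -- at most one flag, so this is paid once.
    · have h1 : laplace (4 * σ) (Set.Iio (|eS θ - eT θ| - ζ - r))
          ≤ ENNReal.ofReal (Real.exp (1 / 2 * (Δ / σ)))
            * laplace (4 * σ) (Set.Iio (|eS θ - eT' θ| - ζ - (r + Δ))) := by
        refine (laplace_le_shift (d := 2 * Δ) (e := 2 * Δ) (by positivity)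
          (by rw [abs_of_nonneg (by positivity)]) measurableSet_Iio).trans ?_
        have : 2 * Δ / (4 * σ) = 1 / 2 * (Δ / σ) := by field_simp; ring
        rw [this]
        gcongr
        intro l hl
        simp only [Set.mem_preimage, Set.mem_Iio] at hl ⊢
        linarith
      have h2 : ∫⁻ x, G j (i + 1) (extend h (θ, Sum.inl (eT θ + x, true))) ∂laplace σ
          ≤ ENNReal.ofReal (Real.exp (Δ / σ))
            * ∫⁻ x, G j (i + 1) (extend h (θ, Sum.inl (eT' θ + x, true))) ∂laplace σ := by
        refine (lintegral_laplace_le_shift (d := eT' θ - eT θ) (e := Δ) hσ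
          (by rw [abs_sub_comm]; exact hΔ θ) (measurable_extend_flag hG j i h θ _)).trans_eq ?_
        have : ∀ x, eT θ + (x + (eT' θ - eT θ)) = eT' θ + x := fun x => by ring
        simp only [this]
      refine (mul_le_mul' h1 h2).trans_eq ?_
      have : (3 : ℝ) / 2 * (Δ / σ) = 1 / 2 * (Δ / σ) + Δ / σ := by ring
      rw [this, Real.exp_add, ENNReal.ofReal_mul (Real.exp_pos _).le]
      ring
    -- Without a flag, the raised `ρ` makes the event more likely, and the reply does not involve
    -- `T`: the round costs nothing.
    · have h1 : laplace (4 * σ) (Set.Ici (|eS θ - eT θ| - ζ - r))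
          ≤ laplace (4 * σ) (Set.Ici (|eS θ - eT' θ| - ζ - (r + Δ))) := by
        refine measure_mono (Set.Ici_subset_Ici.2 ?_)
        linarith
      refine (mul_le_mul' h1 (ih _ _)).trans_eq ?_
      ring

/-- One epoch is differentially private. -/
lemma epochMean_le_mul (hσ : 0 < σ) {Δ : ℝ} (hΔ : ∀ θ, |eT θ - eT' θ| ≤ Δ)
    (heS : Measurable eS) (heT : Measurable eT)
    (hG : ∀ j i, Measurable (G j i)) (j i : ℕ) (h : History Θ i) :
    epochMean κ ζ σ eS eT G j i h
      ≤ ENNReal.ofReal (Real.exp (2 * (Δ / σ))) * epochMean κ ζ σ eS eT' G j i h := by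
  have hΔ0 : 0 ≤ Δ :=
    (abs_nonneg _).trans (hΔ (nonempty_of_isProbabilityMeasure (κ i h)).some)
  unfold epochMean
  -- The shift of `ρ` at scale `2σ` costs `Δ/(2σ)`, which completes `3/2` to `2`.
  refine (lintegral_laplace_le_shift (d := -Δ) (e := Δ) (by positivity)
    (by rw [abs_neg, abs_of_nonneg hΔ0]) (measurable_epochVal_left heS heT hG j i h)).trans ?_
  refine (mul_le_mul_right (lintegral_mono fun r =>
    epochVal_le_shift hσ hΔ hG j i (r + -Δ) h) _).trans ?_
  simp only [neg_add_cancel_right]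
  rw [lintegral_const_mul' _ _ ENNReal.ofReal_ne_top, ← mul_assoc,
    ← ENNReal.ofReal_mul (Real.exp_pos _).le, ← Real.exp_add]
  refine le_of_eq ?_
  congr 3
  field_simp; ring

/-- One epoch is differentially private, in the form of a moment bound. -/
lemma epochMean_rpow_le (hσ : 0 < σ) {Δ s : ℝ} (hs : 1 < s) (hΔ : ∀ θ, |eT θ - eT' θ| ≤ Δ)
    (hk : Real.exp (2 * (Δ / σ)) - 1 ≤ (s - 1) / (2 * s))
    (heS : Measurable eS) (heT : Measurable eT) (heT' : Measurable eT')
    (hG : ∀ j i, Measurable (G j i)) (hG1 : ∀ j i h, G j i h ≤ 1) (j i : ℕ) (h : History Θ i) :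
    epochMean κ ζ σ eS eT (fun j i h => G j i h ^ s⁻¹) j i h
      ≤ ENNReal.ofReal (1 + 17 * s * (Real.exp (2 * (Δ / σ)) - 1) ^ 2 / (s - 1))
        * epochMean κ ζ σ eS eT' G j i h ^ s⁻¹ := by
  have hΔ0 : 0 ≤ Δ :=
    (abs_nonneg _).trans (hΔ (nonempty_of_isProbabilityMeasure (κ i h)).some)
  have hη : 0 ≤ Real.exp (2 * (Δ / σ)) - 1 := by
    rw [sub_nonneg, Real.one_le_exp_iff]; positivity
  have hs0 : 0 < s := by linarith
  have hs1 : 0 < s - 1 := by linarith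
  have hexp : ENNReal.ofReal (Real.exp (2 * (Δ / σ)))
      = 1 + ENNReal.ofReal (Real.exp (2 * (Δ / σ)) - 1) := by
    rw [← ENNReal.ofReal_one, ← ENNReal.ofReal_add zero_le_one hη]; congr 1; ring
  set η := Real.exp (2 * (Δ / σ)) - 1 with hηdef
  have hinv : (1 : ℝ) - 1 / s ≥ 0 := by
    rw [ge_iff_le, sub_nonneg, div_le_one hs0]; exact hs.le
  refine le_rpow_of_forall_young hs (by positivity) (epochMean_le hσ hG1 j i h) fun w hw => ?_
  set g : ℕ → ∀ i, History Θ i → ℝ≥0∞ := fun j i h => G j i h ^ s⁻¹ with hg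
  set p : ℕ → ∀ i, History Θ i → ℝ≥0∞ := fun j i h => g j i h - ENNReal.ofReal w with hp
  set n : ℕ → ∀ i, History Θ i → ℝ≥0∞ := fun j i h => ENNReal.ofReal w - g j i h with hn
  have hgm : ∀ j i, Measurable (g j i) := fun j i => (hG j i).pow_const _
  have hpm : ∀ j i, Measurable (p j i) := fun j i => (hgm j i).sub_const _
  have hnm : ∀ j i, Measurable (n j i) := fun j i => measurable_const.sub (hgm j i)
  have hg1 : ∀ j i h, g j i h ≤ 1 := fun j i h =>
    ENNReal.rpow_le_one (hG1 j i h) (inv_nonneg.2 hs0.le)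
  have hnw : ∀ j i h, n j i h ≤ ENNReal.ofReal w := fun j i h => tsub_le_self
  have hbal : ∀ e : Θ → ℝ, Measurable e →
      epochMean κ ζ σ eS e g j i h + epochMean κ ζ σ eS e n j i h
        = ENNReal.ofReal w + epochMean κ ζ σ eS e p j i h := by
    intro e he
    rw [← epochMean_add heS he hgm]
    rw [← epochMean_const (κ := κ) (ζ := ζ) (eS := eS) (eT := e) hσ (ENNReal.ofReal w) j i h]
    rw [← epochMean_add heS he (fun _ _ => measurable_const)]
    congr 1
    funext j i h
    simp only [hn, hp]
    rw [add_tsub_eq_max, add_tsub_eq_max, max_comm]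
  -- Privacy is used in both directions: from `eT` to `eT'` for the part above `w`, and from `eT'`
  -- to `eT` for the part below.
  have hmain := le_add_excess (hbal eT heT) (hbal eT' heT')
    (hexp ▸ epochMean_le_mul hσ hΔ heS heT hpm j i h)
    (hexp ▸ epochMean_le_mul hσ (fun θ => abs_sub_comm (eT θ) _ ▸ hΔ θ) heS heT' hnm j i h)
    ENNReal.ofReal_ne_top ENNReal.ofReal_ne_top
    ((epochMean_le hσ hg1 j i h).trans_lt ENNReal.one_lt_top).ne
    ((epochMean_le hσ hnw j i h).trans_lt ENNReal.ofReal_lt_top).ne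
    ((epochMean_le hσ hnw j i h).trans_lt ENNReal.ofReal_lt_top).ne
  refine hmain.trans ?_
  rw [← epochMean_const_mul heS heT' hpm, ← epochMean_const_mul heS heT' hnm,
    ← epochMean_add heS heT' hgm,
    ← epochMean_add heS heT' (fun j i => by exact (hgm j i).add ((hpm j i).const_mul _)),
    ← epochMean_const_mul heS heT' hG]
  rw [← epochMean_const (κ := κ) (ζ := ζ) (eS := eS) (eT := eT') hσ
    (ENNReal.ofReal ((1 + 17 * s * η ^ 2 / (s - 1)) * ((1 - 1 / s) * w))) j i h]
  rw [← epochMean_add heS heT' (fun j i => (hG j i).const_mul _)]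
  exact epochMean_mono (fun j i h => young_excess_le hs hη hk hw (hG1 j i h)) j i h

/-- Composition: a moment bound for one epoch gives one for the whole interaction. -/
lemma budgetVal_le_rpow (hσ : 0 < σ) {a : ℝ} {C : ℝ≥0∞} (ha1 : a ≤ 1)
    (heS : Measurable eS) (heT : Measurable eT) (heT' : Measurable eT')
    (hepoch : ∀ G : ℕ → ∀ i, History Θ i → ℝ≥0∞, (∀ j i, Measurable (G j i)) →
      (∀ j i h, G j i h ≤ 1) → ∀ j i h, epochMean κ ζ σ eS eT (fun j i h => G j i h ^ a) j i h
        ≤ C * epochMean κ ζ σ eS eT' G j i h ^ a)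
    (hF : ∀ i, Measurable (F i)) (hF1 : ∀ i h, F i h ≤ 1) (k j i : ℕ) (h : History Θ i) :
    budgetVal κ ζ σ eS eT F k j i h ≤ C ^ k * budgetVal κ ζ σ eS eT' F k j i h ^ a := by
  induction k generalizing j i with
  | zero =>
    -- After the last flag `T` is no longer consulted; both sides hold the same value, and `x ≤ x ^
    -- a` on `[0,1]`.
    rw [pow_zero, one_mul]
    simpa [budgetVal] using ENNReal.rpow_le_rpow_of_exponent_ge (haltVal_le hF1 j i h) ha1
  | succ k ih =>
    have hm := measurable_budgetVal (κ := κ) (ζ := ζ) (σ := σ) heS heT' hF k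
    calc budgetVal κ ζ σ eS eT F (k + 1) j i h
        ≤ epochMean κ ζ σ eS eT (fun j i h => C ^ k * budgetVal κ ζ σ eS eT' F k j i h ^ a) j i h :=
          epochMean_mono ih j i h
      _ = C ^ k * epochMean κ ζ σ eS eT (fun j i h => budgetVal κ ζ σ eS eT' F k j i h ^ a) j i h :=
          epochMean_const_mul heS heT (fun j i => (hm j i).pow_const a) _ j i h
      -- The inductive bound is already an `a`-th power, the form that the epoch bound accepts.
      -- Hence the constants multiply while the exponent stays `a`.
      _ ≤ C ^ k * (C * budgetVal κ ζ σ eS eT' F (k + 1) j i h ^ a) := by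
          gcongr
          exact hepoch _ hm (budgetVal_le hσ hF1 k) j i h
      _ = _ := by rw [pow_succ, mul_assoc]

end Epoch

/-! ### Identification of the backward recursion with the law of the interaction. -/

section Interaction

attribute [local instance] sFinite_laplace

variable {X : Type u} {Θ : Type v} [MeasurableSpace X] [MeasurableSpace Θ] {n : ℕ}
  {q : Θ → X → ℝ}

instance (A : Analyst X Θ n) (i : ℕ) : IsMarkovKernel (A.rule i) := A.markov i

instance (σ : ℝ) : SFinite (noiseLaw σ) := by unfold noiseLaw; infer_instance

lemma isProbabilityMeasure_noiseLaw {σ : ℝ} (hσ : 0 < σ) : IsProbabilityMeasure (noiseLaw σ) := by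
  have := isProbabilityMeasure_laplace hσ
  have := isProbabilityMeasure_laplace (by positivity : 0 < 2 * σ)
  have := isProbabilityMeasure_laplace (by positivity : 0 < 4 * σ)
  unfold noiseLaw; infer_instance

lemma measurable_empMean (hq : Measurable (Function.uncurry q)) :
    Measurable fun p : (Fin n → X) × Θ => empMean p.1 (q p.2) := by
  unfold empMean
  refine (Finset.measurable_sum _ fun j _ => ?_).div_const _
  exact hq.comp (measurable_snd.prodMk ((measurable_pi_apply j).comp measurable_fst))

lemma measurable_empMean_right (hq : Measurable (Function.uncurry q)) (S : Fin n → X) :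
    Measurable fun θ => empMean S (q θ) :=
  (measurable_empMean hq).comp measurable_prodMk_left

lemma measurable_respond {α : Type*} [MeasurableSpace α] {eS eT : α → ℝ} {s : α → State}
    {z : α → Noise} (ζ : ℝ) (hS : Measurable eS) (hT : Measurable eT) (hs : Measurable s)
    (hz : Measurable z) : Measurable fun a => respond ζ (eS a) (eT a) (s a) (z a) := by
  have : (fun a => respond ζ (eS a) (eT a) (s a) (z a)) = fun a =>
      if (s a).1 < 1 then (Sum.inr (), s a)
      else if ζ + (s a).2 + (z a).1 < |eS a - eT a| then
        (Sum.inl (eT a + (z a).2.1, true), ((s a).1 - 1, (z a).2.2))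
      else (Sum.inl (eS a, false), s a) := rfl
  rw [this]
  refine Measurable.ite (measurableSet_lt (by fun_prop) (by fun_prop)) (by fun_prop)
    (Measurable.ite (measurableSet_lt (by fun_prop) (hS.sub hT).abs) ?_ ?_)
  · exact (measurable_inl.comp (by fun_prop)).prodMk (by fun_prop)
  · exact (measurable_inl.comp (by fun_prop)).prodMk (by fun_prop)

lemma measurable_advance (hq : Measurable (Function.uncurry q)) (ζ : ℝ) (i : ℕ) :
    Measurable (advance (n := n) q ζ i) := by
  have : advance (n := n) q ζ i = fun p =>
      ((respond ζ (empMean p.1.1.1.1 (q p.1.2)) (empMean p.1.1.1.2 (q p.1.2)) p.1.1.2.1 p.2).2,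
        extend p.1.1.2.2 (p.1.2, (respond ζ (empMean p.1.1.1.1 (q p.1.2))
          (empMean p.1.1.1.2 (q p.1.2)) p.1.1.2.1 p.2).1)) := rfl
  rw [this]
  have hr : Measurable fun p : ((Data X n × Config Θ i) × Θ) × Noise =>
      respond ζ (empMean p.1.1.1.1 (q p.1.2)) (empMean p.1.1.1.2 (q p.1.2)) p.1.1.2.1 p.2 :=
    measurable_respond ζ
      ((measurable_empMean hq).comp ((by fun_prop : Measurable _).prodMk (by fun_prop)))
      ((measurable_empMean hq).comp ((by fun_prop : Measurable _).prodMk (by fun_prop)))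
      (by fun_prop) (by fun_prop)
  exact hr.snd.prodMk (Measurable.extend (by fun_prop)
    ((by fun_prop : Measurable _).prodMk hr.fst))

lemma isMarkovKernel_queryKernel (A : Analyst X Θ n) (i : ℕ) :
    IsMarkovKernel (queryKernel A i) := by
  unfold queryKernel; infer_instance

lemma isMarkovKernel_stepKernel (hq : Measurable (Function.uncurry q)) (ζ : ℝ) {σ : ℝ}
    (hσ : 0 < σ) (A : Analyst X Θ n) (i : ℕ) : IsMarkovKernel (stepKernel q ζ σ A i) := by
  have := isProbabilityMeasure_noiseLaw hσ
  have := isMarkovKernel_queryKernel A i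
  unfold stepKernel
  exact Kernel.IsMarkovKernel.map _ (measurable_advance hq ζ i)

lemma isMarkovKernel_run (hq : Measurable (Function.uncurry q)) (ζ B : ℝ) {σ : ℝ}
    (hσ : 0 < σ) (A : Analyst X Θ n) (i : ℕ) : IsMarkovKernel (run q ζ B σ A i) := by
  induction i with
  | zero =>
    have := isProbabilityMeasure_laplace (by positivity : 0 < 2 * σ)
    unfold run; infer_instance
  | succ i ih =>
    have := isMarkovKernel_stepKernel hq ζ hσ A i
    unfold run; infer_instance

lemma lintegral_stepKernel (hq : Measurable (Function.uncurry q)) (ζ : ℝ) {σ : ℝ}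
    (hσ : 0 < σ) (A : Analyst X Θ n) (i : ℕ) {f : Config Θ (i + 1) → ℝ≥0∞} (hf : Measurable f)
    (w : Data X n × Config Θ i) :
    ∫⁻ c, f c ∂stepKernel q ζ σ A i w
      = ∫⁻ θ, ∫⁻ z, f (advance q ζ i ((w, θ), z)) ∂noiseLaw σ ∂A.rule i (w.1.1, w.2.2) := by
  have := isProbabilityMeasure_noiseLaw hσ
  have := isMarkovKernel_queryKernel A i
  have hadv := measurable_advance (n := n) hq ζ i
  unfold stepKernel
  rw [Kernel.lintegral_map _ hadv _ hf, Kernel.prod_apply, Kernel.const_apply,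
    lintegral_prod _ (by fun_prop), Kernel.prod_apply, Kernel.id_apply,
    lintegral_prod _ (by fun_prop), lintegral_dirac' _ (by fun_prop)]
  rfl

lemma lintegral_run_succ (hq : Measurable (Function.uncurry q)) (ζ B : ℝ) {σ : ℝ}
    (hσ : 0 < σ) (A : Analyst X Θ n) (i : ℕ) {f : Config Θ (i + 1) → ℝ≥0∞} (hf : Measurable f)
    (d : Data X n) :
    ∫⁻ c, f c ∂run q ζ B σ A (i + 1) d
      = ∫⁻ c, ∫⁻ c', f c' ∂stepKernel q ζ σ A i (d, c) ∂run q ζ B σ A i d := by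
  have := isMarkovKernel_run hq ζ B hσ A i
  have := isMarkovKernel_stepKernel hq ζ hσ A i
  rw [run, Kernel.lintegral_snd _ _ hf, Kernel.lintegral_compProd _ _ _ (by fun_prop)]

/-- The rule of round `i` for a fixed dataset `S`. -/
noncomputable def ruleAt (A : Analyst X Θ n) (S : Fin n → X) (i : ℕ) : Kernel (History Θ i) Θ :=
  (A.rule i).comap (fun h => (S, h)) measurable_prodMk_left

instance (A : Analyst X Θ n) (S : Fin n → X) (i : ℕ) : IsMarkovKernel (ruleAt A S i) := by
  unfold ruleAt; infer_instance

/-- The mean of `F` at the end of the interaction, when `j` rounds are left. -/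
noncomputable def configVal (q : Θ → X → ℝ) (ζ σ : ℝ) (A : Analyst X Θ n)
    (F : ∀ i, History Θ i → ℝ≥0∞) (d : Data X n) (j i : ℕ) (c : Config Θ i) : ℝ≥0∞ :=
  if c.1.1 < 1 then haltVal (ruleAt A d.1) F j i c.2
  else epochVal (ruleAt A d.1) ζ σ (fun θ => empMean d.1 (q θ)) (fun θ => empMean d.2 (q θ))
    (budgetVal (ruleAt A d.1) ζ σ (fun θ => empMean d.1 (q θ)) (fun θ => empMean d.2 (q θ))
      F (⌊c.1.1⌋₊ - 1)) j i c.1.2 c.2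

variable {F : ∀ i, History Θ i → ℝ≥0∞} {ζ σ : ℝ} {A : Analyst X Θ n}

lemma measurable_configVal (hq : Measurable (Function.uncurry q)) (hF : ∀ i, Measurable (F i))
    (d : Data X n) (j i : ℕ) : Measurable (configVal q ζ σ A F d j i) := by
  refine Measurable.ite (measurableSet_lt (by fun_prop) (by fun_prop))
    ((measurable_haltVal hF j i).comp measurable_snd) ?_
  have hnat : Measurable fun c : Config Θ i => ⌊c.1.1⌋₊ - 1 :=
    (measurable_of_countable fun k : ℕ => k - 1).comp (Nat.measurable_floor.comp (by fun_prop))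
  -- The floor takes countably many values, so joint measurability is checked for each value
  -- separately.
  have h := measurable_from_prod_countable_right (α := ℕ) (β := ℝ × History Θ i)
    (f := fun p => epochVal (ruleAt A d.1) ζ σ (fun θ => empMean d.1 (q θ))
      (fun θ => empMean d.2 (q θ)) (budgetVal (ruleAt A d.1) ζ σ (fun θ => empMean d.1 (q θ))
      (fun θ => empMean d.2 (q θ)) F p.1) j i p.2.1 p.2.2)
    (fun k => measurable_epochVal (measurable_empMean_right hq _) (measurable_empMean_right hq _)
      (measurable_budgetVal (measurable_empMean_right hq _) (measurable_empMean_right hq _) hF k)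
      j i)
  exact h.comp (hnat.prodMk ((by fun_prop : Measurable _).prodMk measurable_snd))

/-- Integrating a fresh `ρ` out of `configVal`. -/
lemma lintegral_configVal (hσ : 0 < σ) (d : Data X n) (b : ℝ) (j i : ℕ)
    (h : History Θ i) :
    ∫⁻ r, configVal q ζ σ A F d j i ((b, r), h) ∂laplace (2 * σ)
      = budgetVal (ruleAt A d.1) ζ σ (fun θ => empMean d.1 (q θ)) (fun θ => empMean d.2 (q θ))
        F ⌊b⌋₊ j i h := by
  have := isProbabilityMeasure_laplace (by positivity : 0 < 2 * σ)
  unfold configVal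
  rcases lt_or_ge b 1 with hb1 | hb1
  · simp [hb1, Nat.floor_eq_zero.2 hb1, budgetVal]
  · simp only [not_lt.2 hb1, if_false]
    obtain ⟨k, hk⟩ := Nat.exists_eq_succ_of_ne_zero (Nat.floor_pos.2 hb1).ne'
    rw [hk]
    rfl

lemma budgetVal_zero {κ : ∀ i, Kernel (History Θ i) Θ} {eS eT : Θ → ℝ} (hσ : 0 < σ) (k i : ℕ)
    (h : History Θ i) : budgetVal κ ζ σ eS eT F k 0 i h = F i h := by
  have := isProbabilityMeasure_laplace (by positivity : 0 < 2 * σ)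
  induction k with
  | zero => rfl
  | succ k ih => simp [budgetVal, epochMean, epochVal, ih]

lemma lintegral_laplace_ite (b t : ℝ) (x y : ℝ≥0∞) :
    ∫⁻ l, (if l < t then x else y) ∂laplace b
      = laplace b (Set.Iio t) * x + laplace b (Set.Ici t) * y := by
  rw [← lintegral_add_compl _ (measurableSet_Iio (a := t)), Set.compl_Iio,
    setLIntegral_congr_fun (f := fun l => if l < t then x else y) (g := fun _ => x)
      measurableSet_Iio (fun l hl => if_pos hl),
    setLIntegral_congr_fun (f := fun l => if l < t then x else y) (g := fun _ => y)
      measurableSet_Ici (fun l hl => if_neg (not_lt.2 hl))]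
  simp [mul_comm]

/-- The martingale property of the value function: a forward step of the interaction undoes one
layer of the backward recursion. Iterating it equates the value at the start with the mean of `F` at
the end. -/
lemma lintegral_configVal_step (hq : Measurable (Function.uncurry q)) (hσ : 0 < σ)
    (hF : ∀ i, Measurable (F i)) (d : Data X n) (j i : ℕ) (c : Config Θ i) :
    ∫⁻ c', configVal q ζ σ A F d j (i + 1) c' ∂stepKernel q ζ σ A i (d, c)
      = configVal q ζ σ A F d (j + 1) i c := by
  have := isProbabilityMeasure_noiseLaw hσ
  have := isProbabilityMeasure_laplace hσ
  have := isProbabilityMeasure_laplace (by positivity : 0 < 2 * σ)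
  have hm := measurable_configVal (ζ := ζ) (σ := σ) (A := A) hq hF d j (i + 1)
  rw [lintegral_stepKernel hq ζ hσ A i hm]
  obtain ⟨⟨b, r⟩, h⟩ := c
  obtain ⟨S, T⟩ := d
  rcases lt_or_ge b 1 with hb | hb
  · have h1 : ∀ θ z, configVal q ζ σ A F (S, T) j (i + 1)
        (advance q ζ i ((((S, T), ((b, r), h)), θ), z))
        = haltVal (ruleAt A S) F j (i + 1) (extend h (θ, Sum.inr ())) := by
      intro θ z
      simp [advance, respond, configVal, hb]
    simp only [h1, lintegral_const, measure_univ, mul_one]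
    simp only [configVal, hb, if_true, haltVal]
    rfl
  · have h1 : ∀ θ, ∫⁻ z, configVal q ζ σ A F (S, T) j (i + 1)
        (advance q ζ i ((((S, T), ((b, r), h)), θ), z)) ∂noiseLaw σ
        = laplace (4 * σ) (Set.Iio (|empMean S (q θ) - empMean T (q θ)| - ζ - r)) *
            ∫⁻ x, budgetVal (ruleAt A S) ζ σ (fun θ => empMean S (q θ)) (fun θ => empMean T (q θ))
              F (⌊b⌋₊ - 1) j (i + 1)
              (extend h (θ, Sum.inl (empMean T (q θ) + x, true))) ∂laplace σ
          + laplace (4 * σ) (Set.Ici (|empMean S (q θ) - empMean T (q θ)| - ζ - r)) *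
            epochVal (ruleAt A S) ζ σ (fun θ => empMean S (q θ)) (fun θ => empMean T (q θ))
              (budgetVal (ruleAt A S) ζ σ (fun θ => empMean S (q θ)) (fun θ => empMean T (q θ))
                F (⌊b⌋₊ - 1)) j (i + 1) r (extend h (θ, Sum.inl (empMean S (q θ), false))) := by
      intro θ
      have hadv : Measurable fun z => configVal q ζ σ A F (S, T) j (i + 1)
          (advance q ζ i ((((S, T), ((b, r), h)), θ), z)) :=
        hm.comp ((measurable_advance hq ζ i).comp measurable_prodMk_left)
      rw [noiseLaw, lintegral_prod _ (by exact hadv.aemeasurable), ← lintegral_laplace_ite]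
      refine lintegral_congr fun l => ?_
      rw [lintegral_prod _ (by exact (hadv.comp measurable_prodMk_left).aemeasurable)]
      split_ifs with hl
      · refine lintegral_congr fun x => ?_
        -- A flag lowers `b` by one and draws a new `ρ`; integrating this `ρ` out starts the next
        -- epoch with `⌊b⌋ - 1` flags allowed.
        rw [← Nat.floor_sub_one, ← lintegral_configVal (q := q) (d := (S, T)) hσ]
        refine lintegral_congr fun r' => ?_
        simp only [advance, respond, not_lt.2 hb, if_false,
          if_pos (by linarith : ζ + r + l < |empMean S (q θ) - empMean T (q θ)|)]
      · have hc : ∀ x r', configVal q ζ σ A F (S, T) j (i + 1)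
            (advance q ζ i ((((S, T), ((b, r), h)), θ), (l, x, r')))
            = configVal q ζ σ A F (S, T) j (i + 1)
              ((b, r), extend h (θ, Sum.inl (empMean S (q θ), false))) := by
          intro x r'
          simp only [advance, respond, not_lt.2 hb, if_false,
            if_neg (by linarith : ¬ ζ + r + l < |empMean S (q θ) - empMean T (q θ)|)]
        simp only [hc, lintegral_const, measure_univ, mul_one]
        simp only [configVal, not_lt.2 hb, if_false]
    simp only [h1]
    simp only [configVal, not_lt.2 hb, if_false, epochVal]
    rfl

lemma lintegral_run_configVal (hq : Measurable (Function.uncurry q)) (hσ : 0 < σ)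
    (hF : ∀ i, Measurable (F i)) (B : ℝ) (d : Data X n) (j i : ℕ) :
    ∫⁻ c, configVal q ζ σ A F d j i c ∂run q ζ B σ A i d
      = ∫⁻ c, F (i + j) c.2 ∂run q ζ B σ A (i + j) d := by
  induction j generalizing i with
  | zero =>
    refine lintegral_congr fun c => ?_
    unfold configVal
    split_ifs
    · rfl
    · exact budgetVal_zero hσ _ _ _
  | succ j ih =>
    rw [← Nat.add_assoc, Nat.add_right_comm i j 1, ← ih (i + 1),
      lintegral_run_succ hq ζ B hσ A i (measurable_configVal hq hF d j (i + 1))]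
    simp only [lintegral_configVal_step hq hσ hF]

/-- The law of the record of the interaction, expressed through the backward recursion. -/
lemma lintegral_run_eq_budgetVal (hq : Measurable (Function.uncurry q)) (hσ : 0 < σ)
    (hF : ∀ i, Measurable (F i)) (B : ℝ) (d : Data X n) (m : ℕ) :
    ∫⁻ c, F m c.2 ∂run q ζ B σ A m d
      = budgetVal (ruleAt A d.1) ζ σ (fun θ => empMean d.1 (q θ)) (fun θ => empMean d.2 (q θ))
        F ⌊B⌋₊ m 0 Fin.elim0 := by
  have h := lintegral_run_configVal (ζ := ζ) (A := A) hq hσ hF B d m 0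
  have hm := measurable_configVal (ζ := ζ) (σ := σ) (A := A) hq hF d m 0
  rw [zero_add] at h
  rw [← h, ← lintegral_configVal hσ d B, run, Kernel.const_apply,
    lintegral_prod_symm _ hm.aemeasurable, lintegral_dirac' _ (by fun_prop),
    lintegral_prod _ (by fun_prop), lintegral_dirac' _ (by fun_prop)]

end Interaction

/-! ### The mean of the largest noise excess. -/

section Noise

attribute [local instance] sFinite_laplace

variable {X : Type u} {Θ : Type v} [MeasurableSpace X] [MeasurableSpace Θ] {n : ℕ}
  {q : Θ → X → ℝ}

/-- The numerical answer of a reply. -/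
def replyVal : Reply → ℝ := Sum.elim Prod.fst fun _ => 0

/-- Whether a reply is an answer. -/
def isAnswer : Reply → Bool := Sum.elim (fun _ => true) fun _ => false

/-- Whether a reply is flagged. -/
def isFlagged : Reply → Bool := Sum.elim Prod.snd fun _ => false

lemma measurable_replyVal : Measurable replyVal := measurable_fst.sumElim measurable_const

lemma measurable_isAnswer : Measurable isAnswer := measurable_const.sumElim measurable_const

lemma measurable_isFlagged : Measurable isFlagged := measurable_snd.sumElim measurable_const

/-- How far the noise in one round exceeded its allowance, as far as this can be read off from the
datasets, the query and the reply. -/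
noncomputable def excess (q : Θ → X → ℝ) (ζ t : ℝ) (d : Data X n) (e : Θ × Reply) : ℝ≥0∞ :=
  if isAnswer e.2 then
    if isFlagged e.2 then
      max (ENNReal.ofReal (|replyVal e.2 - empMean d.2 (q e.1)| - 6 * t))
        (ENNReal.ofReal (ζ - |empMean d.1 (q e.1) - empMean d.2 (q e.1)| - 6 * t))
    else ENNReal.ofReal (|replyVal e.2 - empMean d.2 (q e.1)| - ζ - 6 * t)
  else 0

/-- The largest excess in the record. -/
noncomputable def maxExcess (q : Θ → X → ℝ) (ζ t : ℝ) (d : Data X n) {i : ℕ} (h : History Θ i) :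
    ℝ≥0∞ := ⨆ j, excess q ζ t d (h j)

lemma measurable_excess (hq : Measurable (Function.uncurry q)) (ζ t : ℝ) :
    Measurable fun p : Data X n × (Θ × Reply) => excess q ζ t p.1 p.2 := by
  have h1 : Measurable fun p : Data X n × (Θ × Reply) => empMean p.1.1 (q p.2.1) :=
    (measurable_empMean hq).comp ((by fun_prop : Measurable _).prodMk (by fun_prop))
  have h2 : Measurable fun p : Data X n × (Θ × Reply) => empMean p.1.2 (q p.2.1) :=
    (measurable_empMean hq).comp ((by fun_prop : Measurable _).prodMk (by fun_prop))
  have h3 : Measurable fun p : Data X n × (Θ × Reply) => replyVal p.2.2 :=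
    measurable_replyVal.comp (by fun_prop)
  have h4 := (h3.sub h2).abs
  have h5 := (h1.sub h2).abs
  refine Measurable.ite ((measurable_isAnswer.comp (by fun_prop)) (measurableSet_singleton true))
    (Measurable.ite ((measurable_isFlagged.comp (by fun_prop)) (measurableSet_singleton true))
      (Measurable.max ?_ ?_) ?_) measurable_const
  · exact (h4.sub_const _).ennreal_ofReal
  · exact ((h5.const_sub _).sub_const _).ennreal_ofReal
  · exact ((h4.sub_const _).sub_const _).ennreal_ofReal

lemma measurable_maxExcess (hq : Measurable (Function.uncurry q)) (ζ t : ℝ) (i : ℕ) :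
    Measurable fun p : Data X n × History Θ i => maxExcess q ζ t p.1 p.2 := by
  exact Measurable.iSup fun j => (measurable_excess hq ζ t).comp
    (measurable_fst.prodMk ((measurable_pi_apply j).comp measurable_snd))

omit [MeasurableSpace X] [MeasurableSpace Θ] in
lemma maxExcess_extend_le (ζ t : ℝ) (d : Data X n) {i : ℕ} (h : History Θ i) (e : Θ × Reply)
    {c : ℝ≥0∞} (h1 : maxExcess q ζ t d h ≤ c) (h2 : excess q ζ t d e ≤ c) :
    maxExcess q ζ t d (extend h e) ≤ c := by
  refine iSup_le fun j => ?_
  refine Fin.lastCases ?_ (fun j => ?_) j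
  · simpa using h2
  · simpa using (le_iSup (fun j => excess q ζ t d (h j)) j).trans h1

omit [MeasurableSpace X] [MeasurableSpace Θ] in
/-- In each round the excess is bounded by the excesses of the three noise variables. -/
lemma potential_advance_le {ζ t : ℝ} (ht : 0 ≤ t) {i : ℕ} (d : Data X n) (b r : ℝ)
    (h : History Θ i) (θ : Θ) (l x r' : ℝ) :
    max (maxExcess q ζ t d (advance q ζ i (((d, ((b, r), h)), θ), (l, x, r'))).2)
        (ENNReal.ofReal (|(advance q ζ i (((d, ((b, r), h)), θ), (l, x, r'))).1.2| - 2 * t))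
      ≤ max (maxExcess q ζ t d h) (ENNReal.ofReal (|r| - 2 * t))
        + (ENNReal.ofReal (|l| - 4 * t) + (ENNReal.ofReal (|x| - t)
          + ENNReal.ofReal (|r'| - 2 * t))) := by
  obtain ⟨S, T⟩ := d
  have hl : |r| + |l| - 6 * t = (|r| - 2 * t) + (|l| - 4 * t) := by ring
  have hrl : ENNReal.ofReal (|r| + |l| - 6 * t)
      ≤ ENNReal.ofReal (|r| - 2 * t) + ENNReal.ofReal (|l| - 4 * t) := by
    rw [hl]; exact ENNReal.ofReal_add_le
  have hM : maxExcess q ζ t (S, T) h ≤ max (maxExcess q ζ t (S, T) h)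
      (ENNReal.ofReal (|r| - 2 * t)) := le_max_left _ _
  have hR : ENNReal.ofReal (|r| - 2 * t) ≤ max (maxExcess q ζ t (S, T) h)
      (ENNReal.ofReal (|r| - 2 * t)) := le_max_right _ _
  set P := max (maxExcess q ζ t (S, T) h) (ENNReal.ofReal (|r| - 2 * t))
  have habs : ∀ y : ℝ, -|y| ≤ y := neg_abs_le
  -- A flag despite a small gap needs large `|ρ| + |λ|`. The share of `ρ`, which persists through
  -- the epoch, was charged to the potential when it was drawn; only `λ` is new.
  have hflag : ∀ g, ζ + r + l < g → ENNReal.ofReal (ζ - g - 6 * t)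
      ≤ P + ENNReal.ofReal (|l| - 4 * t) := by
    intro g hg
    refine (ENNReal.ofReal_le_ofReal ?_).trans (hrl.trans (add_le_add_left hR _))
    linarith [habs r, habs l]
  by_cases hb : b < 1
  · simp only [advance, respond, hb, if_true]
    refine max_le ((maxExcess_extend_le ζ t _ h _ hM ?_).trans le_self_add)
      (hR.trans le_self_add)
    simp [excess, isAnswer]
  · simp only [advance, respond, hb, if_false]
    by_cases hf : ζ + r + l < |empMean S (q θ) - empMean T (q θ)|
    · simp only [hf, if_true]
      refine max_le (maxExcess_extend_le ζ t _ h _ (hM.trans le_self_add) ?_) ?_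
      · simp only [excess, isAnswer, isFlagged, replyVal, Sum.elim_inl, if_true]
        refine max_le ?_ ((hflag _ hf).trans ?_)
        · rw [add_sub_cancel_left]
          exact (ENNReal.ofReal_le_ofReal (by linarith)).trans
            (le_self_add.trans (le_add_self.trans le_add_self))
        · gcongr
          exact le_self_add
      · exact le_add_self.trans (le_add_self.trans le_add_self)
    · simp only [hf, if_false]
      refine max_le (maxExcess_extend_le ζ t _ h _ (hM.trans le_self_add) ?_)
        (hR.trans le_self_add)
      simp only [excess, isAnswer, isFlagged, replyVal, Sum.elim_inl, if_true,
        Bool.false_eq_true, if_false]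
      refine (ENNReal.ofReal_le_ofReal ?_).trans (hrl.trans (add_le_add hR le_self_add))
      have := le_abs_self r
      have := le_abs_self l
      linarith [not_lt.1 hf]

/-- The allowances `4t`, `t`, `2t` are proportional to the scales, so all three tails are `exp (-t /
σ)` and the prefactors add up to `4 + 1 + 2 = 7`. -/
lemma lintegral_noise_excess {σ : ℝ} (hσ : 0 < σ) (t : ℝ) :
    ∫⁻ z, (ENNReal.ofReal (|z.1| - 4 * t) + (ENNReal.ofReal (|z.2.1| - t)
          + ENNReal.ofReal (|z.2.2| - 2 * t))) ∂noiseLaw σ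
      ≤ ENNReal.ofReal (7 * σ * Real.exp (-t / σ)) := by
  have := isProbabilityMeasure_laplace hσ
  have := isProbabilityMeasure_laplace (by positivity : 0 < 2 * σ)
  have := isProbabilityMeasure_laplace (by positivity : 0 < 4 * σ)
  have h1 := lintegral_laplace_excess (4 * t) (by positivity : 0 < 4 * σ)
  have h2 := lintegral_laplace_excess t hσ
  have h3 := lintegral_laplace_excess (2 * t) (by positivity : 0 < 2 * σ)
  have e1 : -(4 * t) / (4 * σ) = -t / σ := by field_simp
  have e3 : -(2 * t) / (2 * σ) = -t / σ := by field_simp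
  rw [e1] at h1
  rw [e3] at h3
  rw [noiseLaw, lintegral_add_left (by fun_prop), lintegral_add_left (by fun_prop),
    lintegral_prod _ (by fun_prop), lintegral_prod _ (by fun_prop),
    lintegral_prod _ (by fun_prop)]
  simp only [lintegral_const, measure_univ, mul_one]
  rw [lintegral_prod _ (by fun_prop), lintegral_prod _ (by fun_prop)]
  simp only [lintegral_const, measure_univ, mul_one]
  refine (add_le_add h1 (add_le_add h2 h3)).trans_eq ?_
  rw [← ENNReal.ofReal_add (by positivity) (by positivity),
    ← ENNReal.ofReal_add (by positivity) (by positivity)]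
  congr 1; ring

/-- The mean of the largest excess in the record. -/
lemma lintegral_potential_le (hq : Measurable (Function.uncurry q)) (ζ B : ℝ) {σ t : ℝ}
    (hσ : 0 < σ) (ht : 0 ≤ t) (A : Analyst X Θ n) (d : Data X n) (i : ℕ) :
    ∫⁻ c, max (maxExcess q ζ t d c.2) (ENNReal.ofReal (|c.1.2| - 2 * t)) ∂run q ζ B σ A i d
      ≤ (i + 1) * ENNReal.ofReal (7 * σ * Real.exp (-t / σ)) := by
  have hmeas : ∀ i, Measurable fun c : Config Θ i =>
      max (maxExcess q ζ t d c.2) (ENNReal.ofReal (|c.1.2| - 2 * t)) := fun i =>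
    ((measurable_maxExcess hq ζ t i).comp (measurable_const.prodMk measurable_snd)).max
      (by fun_prop)
  induction i with
  | zero =>
    have h0 : ∀ c : Config Θ 0, max (maxExcess q ζ t d c.2) (ENNReal.ofReal (|c.1.2| - 2 * t))
        = ENNReal.ofReal (|c.1.2| - 2 * t) := fun c => by simp [maxExcess]
    have h3 := lintegral_laplace_excess (2 * t) (by positivity : 0 < 2 * σ)
    have e3 : -(2 * t) / (2 * σ) = -t / σ := by field_simp
    rw [e3] at h3
    simp only [h0, run, Kernel.const_apply]
    rw [lintegral_prod _ (by fun_prop)]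
    simp only [lintegral_const, measure_univ, mul_one]
    rw [lintegral_prod _ (by fun_prop), lintegral_dirac]
    refine h3.trans ?_
    simp only [Nat.cast_zero, zero_add, one_mul]
    gcongr
    linarith
  | succ i ih =>
    have := isMarkovKernel_run hq ζ B hσ A i
    have := isProbabilityMeasure_noiseLaw hσ
    rw [lintegral_run_succ hq ζ B hσ A i (hmeas (i + 1))]
    calc _ ≤ ∫⁻ c, (max (maxExcess q ζ t d c.2) (ENNReal.ofReal (|c.1.2| - 2 * t))
          + ENNReal.ofReal (7 * σ * Real.exp (-t / σ))) ∂run q ζ B σ A i d := by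
          refine lintegral_mono fun c => ?_
          rw [lintegral_stepKernel hq ζ hσ A i (hmeas (i + 1))]
          calc _ ≤ ∫⁻ _, (max (maxExcess q ζ t d c.2) (ENNReal.ofReal (|c.1.2| - 2 * t))
                + ENNReal.ofReal (7 * σ * Real.exp (-t / σ))) ∂A.rule i (d.1, c.2) := by
                obtain ⟨⟨b, r⟩, h⟩ := c
                refine lintegral_mono fun θ => ?_
                refine le_trans (lintegral_mono (g := fun z : Noise =>
                  max (maxExcess q ζ t d h) (ENNReal.ofReal (|r| - 2 * t))
                  + (ENNReal.ofReal (|z.1| - 4 * t) + (ENNReal.ofReal (|z.2.1| - t)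
                    + ENNReal.ofReal (|z.2.2| - 2 * t)))) ?_) ?_
                · rintro ⟨l, x, r'⟩
                  exact potential_advance_le ht d b r h θ l x r'
                rw [lintegral_add_left measurable_const, lintegral_const, measure_univ, mul_one]
                exact add_le_add_right (lintegral_noise_excess hσ t) _
            _ = _ := by simp
      _ ≤ (i + 1) * ENNReal.ofReal (7 * σ * Real.exp (-t / σ))
          + ENNReal.ofReal (7 * σ * Real.exp (-t / σ)) := by
          rw [lintegral_add_left (hmeas i), lintegral_const, measure_univ, mul_one]
          gcongr
      _ = _ := by push_cast; ring

end Noise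

/-! ### The score of the first bad round, and its gap between sample and population. -/

section Score

variable {X : Type u} {Θ : Type v} [MeasurableSpace X] [MeasurableSpace Θ] {n : ℕ}
  {D : Measure X} {q : Θ → X → ℝ} {τ : ℝ}

/-- The error of the answer in one round. -/
noncomputable def deviation (D : Measure X) (q : Θ → X → ℝ) (e : Θ × Reply) : ℝ :=
  replyVal e.2 - ∫ x, q e.1 x ∂D

/-- The rounds that are answered with an error of more than `τ`. -/
def badEntry (D : Measure X) (q : Θ → X → ℝ) (τ : ℝ) : Set (Θ × Reply) :=
  {e | isAnswer e.2 = true ∧ τ < |deviation D q e|}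

/-- The records with a bad round. -/
def badRecord (D : Measure X) (q : Θ → X → ℝ) (τ : ℝ) (i : ℕ) : Set (History Θ i) :=
  {h | ∃ j, h j ∈ badEntry D q τ}

open Classical in
/-- On a bad round, the query or its complement, whichever is overestimated on the dataset. -/
noncomputable def entryScore (D : Measure X) (q : Θ → X → ℝ) (τ : ℝ) (x : X) (e : Θ × Reply) :
    ℝ≥0∞ :=
  if e ∈ badEntry D q τ then
    if 0 < deviation D q e then ENNReal.ofReal (q e.1 x) else ENNReal.ofReal (1 - q e.1 x)
  else 0

open Classical in
/-- The score of the first bad round. -/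
noncomputable def score (D : Measure X) (q : Θ → X → ℝ) (τ : ℝ) (x : X) :
    ∀ i, History Θ i → ℝ≥0∞
  | 0, _ => 0
  | i + 1, h => if Fin.init h ∈ badRecord D q τ i then score D q τ x i (Fin.init h)
      else entryScore D q τ x (h (Fin.last i))

variable [IsProbabilityMeasure D]

omit [IsProbabilityMeasure D] [MeasurableSpace Θ] in
lemma badRecord_succ {i : ℕ} (h : History Θ (i + 1)) :
    h ∈ badRecord D q τ (i + 1)
      ↔ Fin.init h ∈ badRecord D q τ i ∨ h (Fin.last i) ∈ badEntry D q τ := by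
  constructor
  · rintro ⟨j, hj⟩
    revert hj
    refine Fin.lastCases (fun hj => Or.inr hj) (fun j hj => Or.inl ⟨j, hj⟩) j
  · rintro (⟨j, hj⟩ | h)
    exacts [⟨j.castSucc, hj⟩, ⟨Fin.last i, h⟩]

lemma measurable_deviation (hq : Measurable (Function.uncurry q)) :
    Measurable (deviation D q) := by
  have : Measurable fun θ => ∫ x, q θ x ∂D :=
    (hq.stronglyMeasurable.integral_prod_right (ν := D)).measurable
  exact (measurable_replyVal.comp measurable_snd).sub (this.comp measurable_fst)

lemma measurableSet_badEntry (hq : Measurable (Function.uncurry q)) :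
    MeasurableSet (badEntry D q τ) :=
  ((measurable_isAnswer.comp measurable_snd) (measurableSet_singleton true)).inter
    (measurableSet_lt measurable_const (measurable_deviation hq).abs)

lemma measurableSet_badRecord (hq : Measurable (Function.uncurry q)) (i : ℕ) :
    MeasurableSet (badRecord (Θ := Θ) D q τ i) := by
  have : badRecord (Θ := Θ) D q τ i = ⋃ j, (fun h : History Θ i => h j) ⁻¹' badEntry D q τ := by
    ext; simp [badRecord]
  rw [this]
  exact MeasurableSet.iUnion fun j => measurable_pi_apply j (measurableSet_badEntry hq)

lemma measurable_entryScore (hq : Measurable (Function.uncurry q)) :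
    Measurable fun p : X × (Θ × Reply) => entryScore D q τ p.1 p.2 := by
  have h : Measurable fun p : X × (Θ × Reply) => q p.2.1 p.1 :=
    hq.comp ((by fun_prop : Measurable _).prodMk measurable_fst)
  refine Measurable.ite (measurable_snd (measurableSet_badEntry hq)) (Measurable.ite
    (measurableSet_lt measurable_const ((measurable_deviation hq).comp measurable_snd))
    h.ennreal_ofReal (h.const_sub 1).ennreal_ofReal) measurable_const

lemma measurable_init (i : ℕ) :
    Measurable fun h : History Θ (i + 1) => (Fin.init h : History Θ i) :=
  measurable_pi_iff.2 fun j => measurable_pi_apply j.castSucc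

lemma measurable_score (hq : Measurable (Function.uncurry q)) (i : ℕ) :
    Measurable fun p : X × History Θ i => score D q τ p.1 i p.2 := by
  induction i with
  | zero => exact measurable_const
  | succ i ih =>
    have h1 : Measurable fun p : X × History Θ (i + 1) => (Fin.init p.2 : History Θ i) :=
      (measurable_init i).comp measurable_snd
    refine Measurable.ite (h1 (measurableSet_badRecord hq i))
      (ih.comp (measurable_fst.prodMk h1)) ?_
    exact (measurable_entryScore hq).comp
      (measurable_fst.prodMk ((measurable_pi_apply (Fin.last i)).comp measurable_snd))

omit [IsProbabilityMeasure D] [MeasurableSpace Θ] in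
lemma entryScore_le_one (hq1 : ∀ θ x, q θ x ∈ Set.Icc (0 : ℝ) 1) (x : X) (e : Θ × Reply) :
    entryScore D q τ x e ≤ 1 := by
  unfold entryScore
  split_ifs
  · exact ENNReal.ofReal_le_one.2 (hq1 _ _).2
  · exact ENNReal.ofReal_le_one.2 (by linarith [(hq1 e.1 x).1])
  · exact zero_le_one

-- Besides making the score vanish on good records, this yields the inequality `u ≤ p` of the final
-- argument.
omit [IsProbabilityMeasure D] [MeasurableSpace Θ] in
lemma score_le_indicator (hq1 : ∀ θ x, q θ x ∈ Set.Icc (0 : ℝ) 1) (x : X) (i : ℕ)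
    (h : History Θ i) : score D q τ x i h ≤ (badRecord D q τ i).indicator 1 h := by
  induction i with
  | zero => exact zero_le
  | succ i ih =>
    unfold score
    split_ifs with hb
    · rw [Set.indicator_of_mem ((badRecord_succ h).2 (Or.inl hb))]
      refine (ih _).trans ?_
      rw [Set.indicator_of_mem hb]
      rfl
    · by_cases he : h (Fin.last i) ∈ badEntry D q τ
      · rw [Set.indicator_of_mem ((badRecord_succ h).2 (Or.inr he))]
        exact entryScore_le_one hq1 _ _
      · simp [entryScore, he]

omit [IsProbabilityMeasure D] [MeasurableSpace Θ] in
lemma score_le_one (hq1 : ∀ θ x, q θ x ∈ Set.Icc (0 : ℝ) 1) (x : X) (i : ℕ)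
    (h : History Θ i) : score D q τ x i h ≤ 1 :=
  (score_le_indicator hq1 x i h).trans (Set.indicator_le_self' (fun _ _ => zero_le) h)

omit [MeasurableSpace X] in
lemma sum_ofReal_div (hn : 0 < n) (T : Fin n → X) {f : X → ℝ} (hf : ∀ x, 0 ≤ f x) :
    (∑ j, ENNReal.ofReal (f (T j))) / n = ENNReal.ofReal (empMean T f) := by
  rw [empMean, ENNReal.ofReal_div_of_pos (by exact_mod_cast hn), ENNReal.ofReal_natCast,
    ENNReal.ofReal_sum_of_nonneg fun j _ => hf _]

omit [MeasurableSpace X] in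
lemma empMean_one_sub (hn : 0 < n) (T : Fin n → X) (f : X → ℝ) :
    empMean T (fun x => 1 - f x) = 1 - empMean T f := by
  have : (n : ℝ) ≠ 0 := by positivity
  simp only [empMean, Finset.sum_sub_distrib, Finset.sum_const, Finset.card_univ,
    Fintype.card_fin, nsmul_eq_mul, mul_one]
  field_simp

lemma integrable_query (hq : Measurable (Function.uncurry q))
    (hq1 : ∀ θ x, q θ x ∈ Set.Icc (0 : ℝ) 1) (θ : Θ) : Integrable (q θ) D :=
  Integrable.of_bound (hq.comp measurable_prodMk_left).aestronglyMeasurable 1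
    (ae_of_all _ fun x => by
      rw [Real.norm_eq_abs, abs_of_nonneg (hq1 θ x).1]; exact (hq1 θ x).2)

/-- On a bad round, the mean of the score on `T` exceeds its population mean unless the noise was
large. -/
lemma entryScore_gap (hn : 0 < n) (hq : Measurable (Function.uncurry q))
    (hq1 : ∀ θ x, q θ x ∈ Set.Icc (0 : ℝ) 1) {ζ t : ℝ} (hm : ζ + 6 * t ≤ τ) (hζ : 0 ≤ ζ)
    (d : Data X n) {e : Θ × Reply} (he : e ∈ badEntry D q τ) :
    ∫⁻ x, entryScore D q τ x e ∂D + ENNReal.ofReal (τ - ζ - 6 * t)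
      ≤ (∑ j, entryScore D q τ (d.2 j) e) / n + excess q ζ t d e := by
  set a := replyVal e.2 with ha
  set E := empMean d.2 (q e.1) with hE
  set P := ∫ x, q e.1 x ∂D with hP
  have hexc : ENNReal.ofReal (|a - E| - ζ - 6 * t) ≤ excess q ζ t d e := by
    rw [excess, if_pos he.1]
    split_ifs
    · exact le_max_of_le_left (ENNReal.ofReal_le_ofReal (by linarith))
    · exact le_rfl
  have hdev : deviation D q e = a - P := rfl
  have hP0 : 0 ≤ P := integral_nonneg fun x => (hq1 _ x).1
  have hint := integrable_query (D := D) hq hq1 e.1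
  have hbad := he.2
  rw [hdev] at hbad
  -- The error splits into answer minus mean on `T`, controlled by the excess, and mean on `T` minus
  -- population mean, which must make up the rest of `τ`.
  refine le_trans ?_ (add_le_add_right hexc _)
  by_cases hpos : 0 < deviation D q e
  · simp only [entryScore, he, if_true, hpos]
    rw [sum_ofReal_div hn _ fun x => (hq1 e.1 x).1,
      ← ofReal_integral_eq_lintegral_ofReal hint (ae_of_all _ fun x => (hq1 e.1 x).1)]
    change ENNReal.ofReal P + _ ≤ ENNReal.ofReal E + _
    rw [hdev] at hpos
    rw [abs_of_pos hpos] at hbad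
    rw [← ENNReal.ofReal_add hP0 (by linarith)]
    refine (ENNReal.ofReal_le_ofReal ?_).trans ENNReal.ofReal_add_le
    linarith [le_abs_self (a - E)]
  · simp only [entryScore, he, if_true, hpos, if_false]
    rw [sum_ofReal_div hn _ fun x => sub_nonneg.2 (hq1 e.1 x).2, empMean_one_sub hn,
      ← ofReal_integral_eq_lintegral_ofReal (f := fun x => 1 - q e.1 x)
        ((integrable_const _).sub hint) (ae_of_all _ fun x => sub_nonneg.2 (hq1 e.1 x).2),
      integral_sub (integrable_const _) hint]
    simp only [integral_const, probReal_univ, smul_eq_mul, mul_one]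
    rw [hdev] at hpos
    rw [abs_of_nonpos (not_lt.1 hpos)] at hbad
    have hP1 : P ≤ 1 := by
      have := integral_mono hint (integrable_const 1) fun x => (hq1 e.1 x).2
      simpa using this
    rw [← hP, ← ENNReal.ofReal_add (by linarith) (by linarith)]
    refine (ENNReal.ofReal_le_ofReal ?_).trans ENNReal.ofReal_add_le
    linarith [neg_abs_le (a - E)]

/-- On a record with a bad round, the mean of the score on `T` exceeds its population mean unless
the noise was large. -/
lemma score_gap (hn : 0 < n) (hq : Measurable (Function.uncurry q))
    (hq1 : ∀ θ x, q θ x ∈ Set.Icc (0 : ℝ) 1) {ζ t : ℝ} (hm : ζ + 6 * t ≤ τ) (hζ : 0 ≤ ζ)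
    (d : Data X n) (i : ℕ) {h : History Θ i} (hh : h ∈ badRecord D q τ i) :
    ∫⁻ x, score D q τ x i h ∂D + ENNReal.ofReal (τ - ζ - 6 * t)
      ≤ (∑ j, score D q τ (d.2 j) i h) / n + maxExcess q ζ t d h := by
  induction i with
  | zero => exact hh.choose.elim0
  | succ i ih =>
    by_cases hb : Fin.init h ∈ badRecord D q τ i
    · simp only [score, hb, if_true]
      refine (ih hb).trans (add_le_add_right ?_ _)
      exact iSup_le fun j => le_iSup (fun j => excess q ζ t d (h j)) j.castSucc
    · simp only [score, hb, if_false]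
      refine (entryScore_gap hn hq hq1 hm hζ d (((badRecord_succ h).1 hh).resolve_left hb)).trans
        (add_le_add_right ?_ _)
      exact le_iSup (fun j => excess q ζ t d (h j)) (Fin.last i)

lemma score_gap_indicator (hn : 0 < n) (hq : Measurable (Function.uncurry q))
    (hq1 : ∀ θ x, q θ x ∈ Set.Icc (0 : ℝ) 1) {ζ t : ℝ} (hm : ζ + 6 * t ≤ τ) (hζ : 0 ≤ ζ)
    (d : Data X n) (i : ℕ) (h : History Θ i) :
    ∫⁻ x, score D q τ x i h ∂D
        + ENNReal.ofReal (τ - ζ - 6 * t) * (badRecord D q τ i).indicator 1 h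
      ≤ (∑ j, score D q τ (d.2 j) i h) / n + maxExcess q ζ t d h := by
  by_cases hh : h ∈ badRecord D q τ i
  · simpa [hh] using score_gap hn hq hq1 hm hζ d i hh
  · have : ∀ x, score D q τ x i h = 0 := fun x => by
      simpa [hh] using score_le_indicator (D := D) (τ := τ) hq1 x i h
    simp [this, hh]

end Score

/-! ### Stability under replacement of one point of `T`, and what it implies for the score. -/

section Stability

/-- Jensen's inequality for a concave power, read off from the monotonicity of the `L^p` seminorms
in the exponent. -/
lemma lintegral_rpow_le_rpow_lintegral {α : Type*} [MeasurableSpace α] {μ : Measure α}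
    [IsProbabilityMeasure μ] {f : α → ℝ≥0∞} (hf : Measurable f) {a : ℝ} (ha : 0 < a)
    (ha1 : a ≤ 1) : ∫⁻ x, f x ^ a ∂μ ≤ (∫⁻ x, f x ∂μ) ^ a := by
  have h := eLpNorm'_le_eLpNorm'_of_exponent_le (f := f) ha ha1 (μ := μ)
    hf.aestronglyMeasurable
  simp only [eLpNorm', enorm_eq_self, ENNReal.rpow_one, one_div, inv_one] at h
  rwa [ENNReal.rpow_inv_le_iff ha] at h

variable {X : Type u} {Θ : Type v} [MeasurableSpace X] [MeasurableSpace Θ] {n : ℕ}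
  {D : Measure X} [IsProbabilityMeasure D] {q : Θ → X → ℝ} {τ : ℝ}

/-- A sample point and a fresh point are exchangeable. -/
lemma lintegral_pi_update_swap (j : Fin n) {g : X × (Fin n → X) → ℝ≥0∞} (hg : Measurable g) :
    ∫⁻ T, ∫⁻ x, g (T j, Function.update T j x) ∂D ∂(Measure.pi fun _ : Fin n => D)
      = ∫⁻ T, ∫⁻ x, g (x, T) ∂D ∂(Measure.pi fun _ : Fin n => D) := by
  have hup : ∀ f : (Fin n → X) → ℝ≥0∞, Measurable f →
      ∫⁻ T, ∫⁻ z, f (Function.update T j z) ∂D ∂(Measure.pi fun _ : Fin n => D)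
        = ∫⁻ T, f T ∂(Measure.pi fun _ : Fin n => D) := by
    intro f hf
    rcases isEmpty_or_nonempty (Fin n → X) with h | ⟨⟨T₀⟩⟩
    · simp [Measure.eq_zero_of_isEmpty]
    · rw [lintegral_eq_lmarginal_univ T₀, lintegral_eq_lmarginal_univ T₀ (f := f),
        lmarginal_erase' _ hf (Finset.mem_univ j)]
      have hf2 : Measurable fun T : Fin n → X => ∫⁻ z, f (Function.update T j z) ∂D := by
        have := hf.lmarginal (fun _ : Fin n => D) (s := {j})
        rwa [lmarginal_singleton] at this
      rw [lmarginal_erase' _ hf2 (Finset.mem_univ j)]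
      simp
  have hupd : Measurable fun p : (Fin n → X) × X => Function.update p.1 j p.2 := by
    refine measurable_pi_iff.2 fun k => ?_
    by_cases hk : k = j
    · subst hk; simpa using measurable_snd
    · simp only [Function.update_of_ne hk]
      exact (measurable_pi_apply k).comp measurable_fst
  have h1 : Measurable fun T : Fin n → X => ∫⁻ x, g (T j, Function.update T j x) ∂D :=
    Measurable.lintegral_prod_right' (f := fun p : (Fin n → X) × X =>
      g (p.1 j, Function.update p.1 j p.2)) (hg.comp ((by fun_prop : Measurable _).prodMk hupd))
  have h2 : Measurable fun T : Fin n → X => ∫⁻ x, g (x, T) ∂D := by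
    fun_prop
  -- Resampling coordinate `j` on both sides turns the old and the fresh point into two integration
  -- variables over `D`, which may be swapped.
  rw [← hup _ h1, ← hup _ h2]
  refine lintegral_congr fun T => ?_
  simp only [Function.update_self, Function.update_idem]
  rw [lintegral_lintegral_swap]
  have : Measurable fun z => Function.update T j z := hupd.comp measurable_prodMk_left
  exact (hg.comp ((by fun_prop : Measurable _).prodMk (this.comp measurable_snd))).aemeasurable

omit [MeasurableSpace X] [MeasurableSpace Θ] in
lemma abs_empMean_update_le (hq1 : ∀ θ x, q θ x ∈ Set.Icc (0 : ℝ) 1) (T : Fin n → X) (j : Fin n)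
    (x : X) (θ : Θ) : |empMean T (q θ) - empMean (Function.update T j x) (q θ)| ≤ 1 / n := by
  have hn : (0 : ℝ) < n := by exact_mod_cast j.pos
  rw [empMean, empMean, ← sub_div, abs_div, abs_of_pos hn, ← Finset.sum_sub_distrib]
  gcongr
  rw [Finset.sum_eq_single j]
  · rw [Function.update_self, abs_le]
    constructor <;> linarith [(hq1 θ x).1, (hq1 θ x).2, (hq1 θ (T j)).1, (hq1 θ (T j)).2]
  · intro k _ hk
    rw [Function.update_of_ne hk, sub_self]
  · simp

/-- Replacing one point of `T` changes the law of the record only a little: the moment bound with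
exponent `a` and constant `C`. -/
def IsStable (q : Θ → X → ℝ) (ζ B σ : ℝ) (A : Analyst X Θ n) (m : ℕ) (a : ℝ) (C : ℝ≥0∞) : Prop :=
  ∀ F : ∀ i, History Θ i → ℝ≥0∞, (∀ i, Measurable (F i)) → (∀ i h, F i h ≤ 1) →
    ∀ (S T : Fin n → X) (j : Fin n) (x : X),
      ∫⁻ c, F m c.2 ∂run q ζ B σ A m (S, T)
        ≤ C * (∫⁻ c, F m c.2 ∂run q ζ B σ A m (S, Function.update T j x)) ^ a

lemma isStable_one (hq : Measurable (Function.uncurry q)) (hq1 : ∀ θ x, q θ x ∈ Set.Icc (0 : ℝ) 1)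
    (ζ B : ℝ) {σ : ℝ} (hσ : 0 < σ) (A : Analyst X Θ n) (m : ℕ) :
    IsStable q ζ B σ A m 1 (ENNReal.ofReal (Real.exp (2 * (1 / n / σ))) ^ ⌊B⌋₊) := by
  intro F hF hF1 S T j x
  rw [lintegral_run_eq_budgetVal hq hσ hF, lintegral_run_eq_budgetVal hq hσ hF]
  refine budgetVal_le_rpow hσ le_rfl (measurable_empMean_right hq _)
    (measurable_empMean_right hq _) (measurable_empMean_right hq _) (fun G hG _ j' i h => ?_)
    hF hF1 _ _ _ _
  simp only [ENNReal.rpow_one]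
  exact epochMean_le_mul hσ (abs_empMean_update_le hq1 T j x) (measurable_empMean_right hq _)
    (measurable_empMean_right hq _) hG j' i h

lemma isStable_moment (hq : Measurable (Function.uncurry q))
    (hq1 : ∀ θ x, q θ x ∈ Set.Icc (0 : ℝ) 1) (ζ B : ℝ) {σ s : ℝ} (hσ : 0 < σ) (hs : 1 < s)
    (hk : Real.exp (2 * (1 / n / σ)) - 1 ≤ (s - 1) / (2 * s)) (A : Analyst X Θ n) (m : ℕ) :
    IsStable q ζ B σ A m s⁻¹
      (ENNReal.ofReal (1 + 17 * s * (Real.exp (2 * (1 / n / σ)) - 1) ^ 2 / (s - 1)) ^ ⌊B⌋₊) := by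
  intro F hF hF1 S T j x
  rw [lintegral_run_eq_budgetVal hq hσ hF, lintegral_run_eq_budgetVal hq hσ hF]
  exact budgetVal_le_rpow hσ (inv_le_one_of_one_le₀ hs.le) (measurable_empMean_right hq _)
    (measurable_empMean_right hq _) (measurable_empMean_right hq _) (fun G hG hG1 j' i h =>
      epochMean_rpow_le hσ hs (abs_empMean_update_le hq1 T j x) hk (measurable_empMean_right hq _)
      (measurable_empMean_right hq _) (measurable_empMean_right hq _) hG hG1 j' i h)
    hF hF1 _ _ _ _

/-- Under stability, the score on a sample point has nearly the mean of the score on a fresh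
point. -/
lemma lintegral_score_sample_le (hq : Measurable (Function.uncurry q))
    (hq1 : ∀ θ x, q θ x ∈ Set.Icc (0 : ℝ) 1) {ζ B σ : ℝ} (hσ : 0 < σ) {A : Analyst X Θ n} {m : ℕ}
    {a : ℝ} {C : ℝ≥0∞} (ha : 0 < a) (ha1 : a ≤ 1) (hst : IsStable q ζ B σ A m a C) (j : Fin n) :
    ∫⁻ w, score D q τ (w.1.2 j) m w.2.2 ∂law D q ζ B σ A m
      ≤ C * (∫⁻ w, ∫⁻ x, score D q τ x m w.2.2 ∂D ∂law D q ζ B σ A m) ^ a := by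
  have := isMarkovKernel_run hq ζ B hσ A m
  have hsc := measurable_score (D := D) (τ := τ) hq m
  set H : X × Data X n → ℝ≥0∞ := fun p => ∫⁻ c, score D q τ p.1 m c.2 ∂run q ζ B σ A m p.2 with hH
  have hHm : Measurable H := by
    refine Measurable.lintegral_kernel_prod_right'
      (κ := (run q ζ B σ A m).comap Prod.snd measurable_snd)
      (f := fun p : (X × Data X n) × Config Θ m => score D q τ p.1.1 m p.2.2) ?_
    exact hsc.comp ((by fun_prop : Measurable _).prodMk (by fun_prop))
  have hupd : Measurable fun p : Data X n × X => Function.update p.1.2 j p.2 := by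
    refine measurable_pi_iff.2 fun k => ?_
    by_cases hk : k = j
    · subst hk; simpa using measurable_snd
    · simp only [Function.update_of_ne hk]
      exact (measurable_pi_apply k).comp (measurable_snd.comp measurable_fst)
  set π : Measure (Fin n → X) := Measure.pi fun _ => D with hπ
  have hL : ∫⁻ w, score D q τ (w.1.2 j) m w.2.2 ∂law D q ζ B σ A m
      = ∫⁻ d, H (d.2 j, d) ∂(π.prod π) := by
    rw [law, Measure.lintegral_compProd]
    exact hsc.comp ((by fun_prop : Measurable _).prodMk (by fun_prop))
  have hR : ∫⁻ w, ∫⁻ x, score D q τ x m w.2.2 ∂D ∂law D q ζ B σ A m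
      = ∫⁻ S, ∫⁻ T, ∫⁻ x, H (x, (S, T)) ∂D ∂π ∂π := by
    have h2 : Measurable fun p : Config Θ m × X => score D q τ p.2 m p.1.2 :=
      hsc.comp (measurable_snd.prodMk (by fun_prop))
    have h3 : Measurable fun c : Config Θ m => ∫⁻ x, score D q τ x m c.2 ∂D :=
      Measurable.lintegral_prod_right' h2
    rw [law, Measure.lintegral_compProd (by exact h3.comp measurable_snd)]
    have h1 : ∀ d, ∫⁻ c, ∫⁻ x, score D q τ x m c.2 ∂D ∂run q ζ B σ A m d = ∫⁻ x, H (x, d) ∂D :=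
      fun d => lintegral_lintegral_swap (by exact h2.aemeasurable)
    simp only [h1]
    rw [lintegral_prod _ (by fun_prop)]
  have hK : Measurable fun p : Data X n × X => H (p.1.2 j, (p.1.1, Function.update p.1.2 j p.2)) :=
    hHm.comp ((by fun_prop : Measurable _).prodMk ((by fun_prop : Measurable _).prodMk hupd))
  calc _ = ∫⁻ p, H (p.1.2 j, p.1) ∂((π.prod π).prod D) := by
        rw [hL, lintegral_prod (fun p : Data X n × X => H (p.1.2 j, p.1)) (by fun_prop)]
        simp
    -- Stability is applied to the score frozen at the point `T j`; once that point is replaced in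
    -- `T`, it is a fresh point for the interaction.
    _ ≤ ∫⁻ p, C * H (p.1.2 j, (p.1.1, Function.update p.1.2 j p.2)) ^ a ∂((π.prod π).prod D) := by
        refine lintegral_mono fun p => ?_
        exact hst (score D q τ (p.1.2 j)) (fun i => (measurable_score hq i).comp
          measurable_prodMk_left) (score_le_one hq1 _) p.1.1 p.1.2 j p.2
    _ = C * ∫⁻ p, H (p.1.2 j, (p.1.1, Function.update p.1.2 j p.2)) ^ a ∂((π.prod π).prod D) :=
        lintegral_const_mul _ (hK.pow_const a)
    _ ≤ C * (∫⁻ p, H (p.1.2 j, (p.1.1, Function.update p.1.2 j p.2)) ∂((π.prod π).prod D)) ^ a :=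
        mul_le_mul_right (lintegral_rpow_le_rpow_lintegral hK ha ha1) _
    _ = _ := by
        rw [hR, lintegral_prod _ hK.aemeasurable, lintegral_prod _ (by fun_prop)]
        congr 2
        refine lintegral_congr fun S => ?_
        exact lintegral_pi_update_swap (g := fun p => H (p.1, (S, p.2))) j (by fun_prop)

end Stability

/-! ### Non-adaptive queries: Hoeffding's inequality. -/

section Hoeffding

variable {X : Type u} {Θ : Type v} [MeasurableSpace X] [MeasurableSpace Θ] {n : ℕ}
  {D : Measure X} [IsProbabilityMeasure D] {q : Θ → X → ℝ}

lemma pi_empMean_sub_ge_le (hn : 0 < n) {f : X → ℝ} (hf : Measurable f)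
    (hf1 : ∀ x, f x ∈ Set.Icc (0 : ℝ) 1) {g : ℝ} (hg : 0 ≤ g) :
    (Measure.pi fun _ : Fin n => D) {S | g ≤ empMean S f - ∫ x, f x ∂D}
      ≤ ENNReal.ofReal (Real.exp (-2 * n * g ^ 2)) := by
  have hn' : (0 : ℝ) < n := by exact_mod_cast hn
  have hmean : ∀ j : Fin n, ∫ S, f (S j) ∂(Measure.pi fun _ : Fin n => D) = ∫ x, f x ∂D := by
    intro j
    have hp := measurePreserving_eval (fun _ : Fin n => D) j
    conv_rhs => rw [← hp.map_eq]
    rw [integral_map hp.measurable.aemeasurable hf.aestronglyMeasurable]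
  have hind : iIndepFun (fun (j : Fin n) (S : Fin n → X) => f (S j) - ∫ x, f x ∂D)
      (Measure.pi fun _ : Fin n => D) :=
    iIndepFun_pi (X := fun (_ : Fin n) x => f x - ∫ x, f x ∂D)
      fun _ => (hf.sub_const _).aemeasurable
  have hsub : ∀ j ∈ (Finset.univ : Finset (Fin n)),
      HasSubgaussianMGF (fun S : Fin n → X => f (S j) - ∫ x, f x ∂D)
        ((‖(1 : ℝ) - 0‖₊ / 2) ^ 2) (Measure.pi fun _ : Fin n => D) := by
    intro j _
    have := hasSubgaussianMGF_of_mem_Icc (μ := Measure.pi fun _ : Fin n => D)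
      (X := fun S => f (S j)) (a := 0) (b := 1)
      (hf.comp (measurable_pi_apply j)).aemeasurable (ae_of_all _ fun S => hf1 _)
    rwa [hmean] at this
  have h := HasSubgaussianMGF.measure_sum_ge_le_of_iIndepFun hind hsub (ε := n * g) (by positivity)
  rw [← ofReal_measureReal]
  refine ENNReal.ofReal_le_ofReal (le_trans (le_of_eq ?_) (h.trans (le_of_eq ?_)))
  · congr 1
    ext S
    change g ≤ empMean S f - ∫ x, f x ∂D ↔ n * g ≤ ∑ j, (f (S j) - ∫ x, f x ∂D)
    rw [Finset.sum_sub_distrib, Finset.sum_const, Finset.card_univ, Fintype.card_fin,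
      nsmul_eq_mul, empMean]
    have : (∑ j, f (S j)) / n - ∫ x, f x ∂D = (∑ j, f (S j) - n * ∫ x, f x ∂D) / n := by
      field_simp
    rw [this, le_div_iff₀ hn', mul_comm]
  · congr 1
    simp
    field_simp

lemma pi_abs_empMean_sub_ge_le (hn : 0 < n) {f : X → ℝ} (hf : Measurable f)
    (hf1 : ∀ x, f x ∈ Set.Icc (0 : ℝ) 1) {g : ℝ} (hg : 0 ≤ g) :
    (Measure.pi fun _ : Fin n => D) {S | g ≤ |empMean S f - ∫ x, f x ∂D|}
      ≤ 2 * ENNReal.ofReal (Real.exp (-2 * n * g ^ 2)) := by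
  have h1 := pi_empMean_sub_ge_le (D := D) hn hf hf1 hg
  have h2 := pi_empMean_sub_ge_le (D := D) hn (f := fun x => 1 - f x) (hf.const_sub 1)
    (fun x => ⟨by linarith [(hf1 x).2], by linarith [(hf1 x).1]⟩) hg
  have hint : Integrable f D := Integrable.of_mem_Icc 0 1 hf.aemeasurable (ae_of_all _ hf1)
  rw [integral_sub (integrable_const _) hint] at h2
  simp only [empMean_one_sub hn, integral_const, probReal_univ, smul_eq_mul, mul_one] at h2
  rw [two_mul]
  refine (measure_mono ?_).trans ((measure_union_le _ _).trans (add_le_add h1 h2))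
  intro S hS
  rcases le_abs'.1 (show g ≤ |_| from hS) with h | h
  · right
    change g ≤ 1 - empMean S f - (1 - ∫ x, f x ∂D)
    linarith
  · exact Or.inl h

/-- The empirical means of a fixed query on two independent datasets are close. -/
lemma pi_prod_gap_le (hn : 0 < n) {f : X → ℝ} (hf : Measurable f)
    (hf1 : ∀ x, f x ∈ Set.Icc (0 : ℝ) 1) {g : ℝ} (hg : 0 ≤ g) :
    ((Measure.pi fun _ : Fin n => D).prod (Measure.pi fun _ : Fin n => D))
        {d : Data X n | 2 * g < |empMean d.1 f - empMean d.2 f|}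
      ≤ 4 * ENNReal.ofReal (Real.exp (-2 * n * g ^ 2)) := by
  set π := Measure.pi fun _ : Fin n => D
  set U : Set (Fin n → X) := {S | g ≤ |empMean S f - ∫ x, f x ∂D|} with hU
  have hsub : {d : Data X n | 2 * g < |empMean d.1 f - empMean d.2 f|}
      ⊆ U ×ˢ Set.univ ∪ Set.univ ×ˢ U := by
    rintro ⟨S, T⟩ hd
    by_contra hcon
    simp only [Set.mem_union, Set.mem_prod, Set.mem_univ, and_true, true_and, not_or] at hcon
    have h1 : |empMean S f - ∫ x, f x ∂D| < g := not_le.1 hcon.1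
    have h2 : |empMean T f - ∫ x, f x ∂D| < g := not_le.1 hcon.2
    have h3 : 2 * g < |empMean S f - empMean T f| := hd
    have h4 := abs_sub (empMean S f - ∫ x, f x ∂D) (empMean T f - ∫ x, f x ∂D)
    rw [sub_sub_sub_cancel_right] at h4
    linarith
  have hp := pi_abs_empMean_sub_ge_le (D := D) hn hf hf1 hg
  refine (measure_mono hsub).trans ((measure_union_le _ _).trans ?_)
  rw [Measure.prod_prod, Measure.prod_prod, measure_univ, mul_one, one_mul]
  refine (add_le_add hp hp).trans_eq ?_
  ring

open Classical in
/-- Whether round `i` asks a non-adaptive query whose empirical means differ by more than `g`. -/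
noncomputable def driftEntry (q : Θ → X → ℝ) (g : ℝ) (A : Analyst X Θ n) (d : Data X n) (i : ℕ)
    (θ : Θ) : ℝ≥0∞ :=
  if A.IsNonadaptive i ∧ g < |empMean d.1 (q θ) - empMean d.2 (q θ)| then 1 else 0

/-- The number of such rounds in the record. -/
noncomputable def drift (q : Θ → X → ℝ) (g : ℝ) (A : Analyst X Θ n) (d : Data X n) {i : ℕ}
    (h : History Θ i) : ℝ≥0∞ :=
  ∑ j : Fin i, driftEntry q g A d j (h j).1

lemma measurable_driftEntry (hq : Measurable (Function.uncurry q)) (g : ℝ) (A : Analyst X Θ n)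
    (i : ℕ) : Measurable fun p : Data X n × Θ => driftEntry q g A p.1 i p.2 := by
  have h1 : Measurable fun p : Data X n × Θ => empMean p.1.1 (q p.2) :=
    (measurable_empMean hq).comp ((by fun_prop : Measurable _).prodMk (by fun_prop))
  have h2 : Measurable fun p : Data X n × Θ => empMean p.1.2 (q p.2) :=
    (measurable_empMean hq).comp ((by fun_prop : Measurable _).prodMk (by fun_prop))
  refine Measurable.ite ?_ measurable_const measurable_const
  exact (MeasurableSet.const _).inter (measurableSet_lt measurable_const (h1.sub h2).abs)

lemma measurable_drift (hq : Measurable (Function.uncurry q)) (g : ℝ) (A : Analyst X Θ n)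
    (i : ℕ) : Measurable fun p : Data X n × History Θ i => drift q g A p.1 p.2 := by
  have h : ∀ j : Fin i, Measurable fun p : Data X n × History Θ i => (p.1, (p.2 j).1) := fun j =>
    measurable_fst.prodMk (measurable_fst.comp ((measurable_pi_apply j).comp measurable_snd))
  have h2 : ∀ j : Fin i, Measurable fun p : Data X n × History Θ i =>
      driftEntry q g A p.1 j (p.2 j).1 := fun j => by
    have h3 := (measurable_driftEntry hq g A (j : ℕ)).comp (h j)
    exact h3
  exact Finset.measurable_sum _ fun j _ => h2 j

lemma drift_extend (g : ℝ) (A : Analyst X Θ n) (d : Data X n) {i : ℕ} (h : History Θ i)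
    (e : Θ × Reply) : drift q g A d (extend h e) = drift q g A d h + driftEntry q g A d i e.1 := by
  simp [drift, Fin.sum_univ_castSucc]

lemma lintegral_law (hq : Measurable (Function.uncurry q)) (ζ B : ℝ) {σ : ℝ} (hσ : 0 < σ)
    (A : Analyst X Θ n) (m : ℕ) {f : Data X n × Config Θ m → ℝ≥0∞} (hf : Measurable f) :
    ∫⁻ w, f w ∂law D q ζ B σ A m
      = ∫⁻ d, ∫⁻ c, f (d, c) ∂run q ζ B σ A m d
        ∂((Measure.pi fun _ : Fin n => D).prod (Measure.pi fun _ : Fin n => D)) := by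
  have := isMarkovKernel_run hq ζ B hσ A m
  rw [law, Measure.lintegral_compProd hf]

/-- On average, a non-adaptive round shows a large gap with small probability. -/
lemma lintegral_driftEntry_le (hn : 0 < n) (hq : Measurable (Function.uncurry q))
    (hq1 : ∀ θ x, q θ x ∈ Set.Icc (0 : ℝ) 1) (ζ B : ℝ) {σ : ℝ} (hσ : 0 < σ) (A : Analyst X Θ n)
    {g : ℝ} (hg : 0 ≤ g) (i : ℕ) :
    ∫⁻ d, ∫⁻ c, ∫⁻ θ, driftEntry q (2 * g) A d i θ ∂A.rule i (d.1, c.2) ∂run q ζ B σ A i d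
        ∂((Measure.pi fun _ : Fin n => D).prod (Measure.pi fun _ : Fin n => D))
      ≤ 4 * ENNReal.ofReal (Real.exp (-2 * n * g ^ 2)) := by
  have hrun := isMarkovKernel_run hq ζ B hσ A i
  have hme := measurable_driftEntry hq (2 * g) A i
  by_cases hA : A.IsNonadaptive i
  · obtain ⟨ν, hν⟩ := id hA
    -- Over an empty space a constant Markov kernel does not force `ν` to be a probability measure.
    rcases isEmpty_or_nonempty ((Fin n → X) × History Θ i) with hE | ⟨⟨w₀⟩⟩
    · have : ∀ (d : Data X n) (c : Config Θ i),
          ∫⁻ θ, driftEntry q (2 * g) A d i θ ∂A.rule i (d.1, c.2) = 0 :=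
        fun d c => (hE.false (d.1, c.2)).elim
      simp [this]
    have hνp : IsProbabilityMeasure ν := by
      have : A.rule i w₀ = ν := by rw [hν, Kernel.const_apply]
      rw [← this]; infer_instance
    simp only [hν, Kernel.const_apply, lintegral_const, measure_univ, mul_one]
    -- The law of the query does not depend on the data, so the query can be fixed before the
    -- datasets are drawn.
    rw [lintegral_lintegral_swap hme.aemeasurable]
    calc _ ≤ ∫⁻ _, 4 * ENNReal.ofReal (Real.exp (-2 * n * g ^ 2)) ∂ν := by
          refine lintegral_mono fun θ => ?_
          have hset : MeasurableSet {d : Data X n |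
              2 * g < |empMean d.1 (q θ) - empMean d.2 (q θ)|} := by
            have h1 : Measurable fun S : Fin n → X => empMean S (q θ) :=
              (measurable_empMean hq).comp measurable_prodMk_right
            exact measurableSet_lt measurable_const
              ((h1.comp measurable_fst).sub (h1.comp measurable_snd)).abs
          refine le_trans (le_of_eq ?_) (pi_prod_gap_le (D := D) (f := q θ) hn
            (hq.comp measurable_prodMk_left) (hq1 θ) hg)
          rw [← lintegral_indicator_one hset]
          refine lintegral_congr fun d => ?_
          simp [driftEntry, hA, Set.indicator_apply]
      _ = _ := by simp
  · simp [driftEntry, hA]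

/-- The expected number of non-adaptive rounds with a large gap. -/
lemma lintegral_drift_le (hn : 0 < n) (hq : Measurable (Function.uncurry q))
    (hq1 : ∀ θ x, q θ x ∈ Set.Icc (0 : ℝ) 1) (ζ B : ℝ) {σ : ℝ} (hσ : 0 < σ) (A : Analyst X Θ n)
    {g : ℝ} (hg : 0 ≤ g) (i : ℕ) :
    ∫⁻ w, drift q (2 * g) A w.1 w.2.2 ∂law D q ζ B σ A i
      ≤ i * (4 * ENNReal.ofReal (Real.exp (-2 * n * g ^ 2))) := by
  have hrun := fun i => isMarkovKernel_run hq ζ B hσ A i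
  have hms : ∀ i, Measurable fun w : Data X n × Config Θ i => drift q (2 * g) A w.1 w.2.2 :=
    fun i => by
      have h1 : Measurable fun w : Data X n × Config Θ i => (w.1, w.2.2) :=
        measurable_fst.prodMk (measurable_snd.comp measurable_snd)
      have h2 := (measurable_drift hq (2 * g) A i).comp h1
      exact h2
  induction i with
  | zero => simp [drift]
  | succ i ih =>
    have hp := isProbabilityMeasure_noiseLaw hσ
    rw [lintegral_law hq ζ B hσ A _ (hms i)] at ih
    rw [lintegral_law hq ζ B hσ A _ (hms (i + 1))]
    have hstep : ∀ d, ∫⁻ c, drift q (2 * g) A d c.2 ∂run q ζ B σ A (i + 1) d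
        = ∫⁻ c, drift q (2 * g) A d c.2 ∂run q ζ B σ A i d
          + ∫⁻ c, ∫⁻ θ, driftEntry q (2 * g) A d i θ ∂A.rule i (d.1, c.2) ∂run q ζ B σ A i d := by
      intro d
      have hd : ∀ i, Measurable fun c : Config Θ i => drift q (2 * g) A d c.2 :=
        fun i => by
          have h := (hms i).comp (measurable_prodMk_left (x := d))
          exact h
      have he : Measurable fun θ => driftEntry q (2 * g) A d i θ := by
        have h := (measurable_driftEntry hq (2 * g) A i).comp (measurable_prodMk_left (x := d))
        exact h
      rw [lintegral_run_succ hq ζ B hσ A i (hd (i + 1)), ← lintegral_add_left (hd i)]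
      refine lintegral_congr fun c => ?_
      rw [lintegral_stepKernel hq ζ hσ A i (hd (i + 1))]
      have : ∀ θ z, drift q (2 * g) A d (advance q ζ i (((d, c), θ), z)).2
          = drift q (2 * g) A d c.2 + driftEntry q (2 * g) A d i θ :=
        fun θ z => drift_extend (2 * g) A d c.2 (θ, _)
      simp only [this, lintegral_const, measure_univ, mul_one]
      rw [lintegral_add_left measurable_const]
      simp
    simp only [hstep]
    have hmeas : Measurable fun d => ∫⁻ c, drift q (2 * g) A d c.2 ∂run q ζ B σ A i d :=
      Measurable.lintegral_kernel_prod_right' (hms i)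
    rw [lintegral_add_left hmeas]
    refine (add_le_add ih (lintegral_driftEntry_le hn hq hq1 ζ B hσ A hg i)).trans_eq ?_
    push_cast; ring

end Hoeffding

/-! ### Bounds for the probability of a bad record and of a failure. -/

section Assembly

variable {X : Type u} {Θ : Type v} [MeasurableSpace X] [MeasurableSpace Θ] {n : ℕ}
  {D : Measure X} [IsProbabilityMeasure D] {q : Θ → X → ℝ}

lemma isProbabilityMeasure_law (hq : Measurable (Function.uncurry q)) (ζ B : ℝ) {σ : ℝ}
    (hσ : 0 < σ) (A : Analyst X Θ n) (m : ℕ) : IsProbabilityMeasure (law D q ζ B σ A m) := by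
  have := isMarkovKernel_run hq ζ B hσ A m
  unfold law; infer_instance

lemma lintegral_maxExcess_law_le (hq : Measurable (Function.uncurry q)) (ζ B : ℝ) {σ t : ℝ}
    (hσ : 0 < σ) (ht : 0 ≤ t) (A : Analyst X Θ n) (m : ℕ) :
    ∫⁻ w, maxExcess q ζ t w.1 w.2.2 ∂law D q ζ B σ A m
      ≤ ENNReal.ofReal ((m + 1) * (7 * σ * Real.exp (-t / σ))) := by
  have hm : Measurable fun w : Data X n × Config Θ m => maxExcess q ζ t w.1 w.2.2 := by
    have h := (measurable_maxExcess hq ζ t m (n := n)).comp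
      (measurable_fst.prodMk (measurable_snd.comp measurable_snd) :
        Measurable fun w : Data X n × Config Θ m => (w.1, w.2.2))
    exact h
  rw [lintegral_law hq ζ B hσ A m hm]
  calc _ ≤ ∫⁻ _, (m + 1) * ENNReal.ofReal (7 * σ * Real.exp (-t / σ))
        ∂((Measure.pi fun _ : Fin n => D).prod (Measure.pi fun _ : Fin n => D)) :=
        lintegral_mono fun d => (lintegral_mono fun c => le_max_left _ _).trans
          (lintegral_potential_le hq ζ B hσ ht A d m)
    _ = _ := by
        rw [lintegral_const, measure_univ, mul_one,
          ENNReal.ofReal_mul (p := (m : ℝ) + 1) (by positivity),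
          ENNReal.ofReal_add (by positivity) zero_le_one, ENNReal.ofReal_natCast,
          ENNReal.ofReal_one]

/-- Stability bounds the probability of a bad record: with `p` this probability and `u` the
population mean of the score. -/
lemma exists_score_mean_bounds (hn : 0 < n) (hq : Measurable (Function.uncurry q))
    (hq1 : ∀ θ x, q θ x ∈ Set.Icc (0 : ℝ) 1) {ζ B σ t τ : ℝ} (hσ : 0 < σ) (ht : 0 ≤ t)
    (hm : ζ + 6 * t ≤ τ) (hζ : 0 ≤ ζ) (A : Analyst X Θ n) (m : ℕ) {a C : ℝ} (ha : 0 < a)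
    (ha1 : a ≤ 1) (hC : 0 ≤ C) (hst : IsStable q ζ B σ A m a (ENNReal.ofReal C)) :
    ∃ u : ℝ, 0 ≤ u ∧ u ≤ (law D q ζ B σ A m).real {w | w.2.2 ∈ badRecord D q τ m} ∧
      u + (τ - ζ - 6 * t) * (law D q ζ B σ A m).real {w | w.2.2 ∈ badRecord D q τ m}
        ≤ C * u ^ a + (m + 1) * (7 * σ * Real.exp (-t / σ)) ∧
      (τ - ζ - 6 * t) * (law D q ζ B σ A m).real {w | w.2.2 ∈ badRecord D q τ m}
        ≤ (law D q ζ B σ A m).real {w | w.2.2 ∈ badRecord D q τ m}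
          + (m + 1) * (7 * σ * Real.exp (-t / σ)) := by
  have hprob := isProbabilityMeasure_law (D := D) hq ζ B hσ A m
  set P := law D q ζ B σ A m with hP
  set bad : Set (Data X n × Config Θ m) := {w | w.2.2 ∈ badRecord D q τ m} with hbad
  have hbm : MeasurableSet bad :=
    (measurable_snd.comp measurable_snd) (measurableSet_badRecord hq m)
  have hsc := measurable_score (D := D) (τ := τ) hq m
  have hexc := lintegral_maxExcess_law_le (D := D) hq ζ B hσ ht A m
  have hn0 : (n : ℝ≥0∞) ≠ 0 := by exact_mod_cast hn.ne'
  have hscj : ∀ j : Fin n, Measurable fun w : Data X n × Config Θ m =>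
      score D q τ (w.1.2 j) m w.2.2 := fun j => by
    have h : Measurable fun w : Data X n × Config Θ m => (w.1.2 j, w.2.2) := by fun_prop
    exact hsc.comp h
  have hpop : Measurable fun w : Data X n × Config Θ m => ∫⁻ x, score D q τ x m w.2.2 ∂D := by
    have h : Measurable fun h : History Θ m => ∫⁻ x, score D q τ x m h ∂D :=
      Measurable.lintegral_prod_left' hsc
    exact h.comp (measurable_snd.comp measurable_snd)
  have hle : ∀ x (w : Data X n × Config Θ m), score D q τ x m w.2.2 ≤ bad.indicator 1 w :=
    fun x w => score_le_indicator hq1 x m w.2.2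
  have hind : ∫⁻ w, bad.indicator 1 w ∂P = P bad := lintegral_indicator_one hbm
  set U := ∫⁻ w, ∫⁻ x, score D q τ x m w.2.2 ∂D ∂P with hU
  set M := ∫⁻ w, (∑ j, score D q τ (w.1.2 j) m w.2.2) / n ∂P with hMdef
  have hUle : U ≤ P bad := by
    rw [← hind]
    refine lintegral_mono fun w => ?_
    exact (lintegral_mono fun x => hle x w).trans_eq (by simp)
  have hUtop : U ≠ ∞ := (hUle.trans_lt (measure_lt_top P bad)).ne
  -- A bound that needs no stability; it settles the case of large `τ`.
  have hMle : M ≤ P bad := by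
    rw [← hind]
    refine lintegral_mono fun w => ?_
    refine ENNReal.div_le_of_le_mul ((Finset.sum_le_sum fun j _ => hle _ w).trans_eq ?_)
    rw [Finset.sum_const, Finset.card_univ, Fintype.card_fin, nsmul_eq_mul, mul_comm]
  have hMst : M ≤ ENNReal.ofReal C * U ^ a := by
    have h1 : M = (∑ j : Fin n, ∫⁻ w, score D q τ (w.1.2 j) m w.2.2 ∂P) / n := by
      simp only [hMdef, div_eq_mul_inv]
      rw [lintegral_mul_const _ (Finset.measurable_sum _ fun j _ => hscj j),
        lintegral_finsetSum _ fun j _ => hscj j]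
    rw [h1]
    refine ENNReal.div_le_of_le_mul ((Finset.sum_le_sum fun j _ =>
      lintegral_score_sample_le hq hq1 hσ ha ha1 hst j).trans_eq ?_)
    rw [Finset.sum_const, Finset.card_univ, Fintype.card_fin, nsmul_eq_mul, mul_comm]
  have hgap : U + ENNReal.ofReal (τ - ζ - 6 * t) * P bad
      ≤ M + ENNReal.ofReal ((m + 1) * (7 * σ * Real.exp (-t / σ))) := by
    have h0 : U + ENNReal.ofReal (τ - ζ - 6 * t) * P bad
        = ∫⁻ w, (∫⁻ x, score D q τ x m w.2.2 ∂D
          + ENNReal.ofReal (τ - ζ - 6 * t) * bad.indicator 1 w) ∂P := by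
      rw [lintegral_add_left hpop, lintegral_const_mul _ (measurable_one.indicator hbm), hind]
    rw [h0]
    refine (lintegral_mono fun w : Data X n × Config Θ m =>
      score_gap_indicator hn hq hq1 hm hζ w.1 m w.2.2).trans ?_
    rw [lintegral_add_left ((Finset.measurable_sum _ fun j _ => hscj j).div_const _)]
    exact add_le_add_right hexc _
  have hμ : 0 ≤ τ - ζ - 6 * t := by linarith
  have hN : 0 ≤ (m + 1) * (7 * σ * Real.exp (-t / σ)) := by positivity
  have hUr : U = ENNReal.ofReal U.toReal := (ENNReal.ofReal_toReal hUtop).symm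
  have hPr : P bad = ENNReal.ofReal (P.real bad) := (ofReal_measureReal).symm
  have hlhs : U + ENNReal.ofReal (τ - ζ - 6 * t) * P bad
      = ENNReal.ofReal (U.toReal + (τ - ζ - 6 * t) * P.real bad) := by
    rw [ENNReal.ofReal_add ENNReal.toReal_nonneg (by positivity), ENNReal.ofReal_mul hμ, ← hUr,
      ← hPr]
  refine ⟨U.toReal, ENNReal.toReal_nonneg, ENNReal.toReal_mono (measure_ne_top P bad) hUle, ?_, ?_⟩
  · have h := hgap.trans (add_le_add_left hMst _)
    rw [hlhs] at h
    nth_rewrite 2 [hUr] at h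
    rw [ENNReal.ofReal_rpow_of_nonneg ENNReal.toReal_nonneg ha.le, ← ENNReal.ofReal_mul hC,
      ← ENNReal.ofReal_add (by positivity) hN, ENNReal.ofReal_le_ofReal_iff (by positivity)] at h
    exact h
  · have h := (le_add_self.trans hgap).trans (add_le_add_left hMle _)
    rw [hPr, ← ENNReal.ofReal_mul hμ, ← ENNReal.ofReal_add (by positivity) hN,
      ENNReal.ofReal_le_ofReal_iff (by positivity)] at h
    exact h

omit [IsProbabilityMeasure D] in
/-- A failure needs a bad record, a large excess of the noise, or a non-adaptive round with a large
gap. -/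
lemma compl_goodEvent_subset {ζ t τ g : ℝ} (A : Analyst X Θ n) (m : ℕ) :
    (goodEvent D q τ A m)ᶜ ⊆ {w | w.2.2 ∈ badRecord D q τ m}
      ∪ {w | ENNReal.ofReal (ζ - g - 6 * t) ≤ maxExcess q ζ t w.1 w.2.2}
      ∪ {w | 1 ≤ drift q g A w.1 w.2.2} := by
  classical
  intro w hw
  simp only [goodEvent, Set.mem_compl_iff, Set.mem_ofPred_eq, not_forall] at hw
  obtain ⟨i, a, o, hi, hw⟩ := hw
  by_cases hb : w.2.2 i ∈ badEntry D q τ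
  · exact Or.inl (Or.inl ⟨i, hb⟩)
  have hdev : |a - ∫ x, q (w.2.2 i).1 x ∂D| ≤ τ := by
    by_contra hcon
    refine hb ⟨by rw [hi]; rfl, ?_⟩
    rw [deviation, hi]
    exact not_le.1 hcon
  simp only [hdev, true_and, not_forall] at hw
  obtain ⟨rfl, hA⟩ := hw
  have hA' : A.IsNonadaptive i := not_not.1 hA
  by_cases hg : g < |empMean w.1.1 (q (w.2.2 i).1) - empMean w.1.2 (q (w.2.2 i).1)|
  · refine Or.inr ?_
    have h1 : driftEntry q g A w.1 i (w.2.2 i).1 = 1 := if_pos ⟨hA', hg⟩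
    change 1 ≤ ∑ j : Fin m, driftEntry q g A w.1 j (w.2.2 j).1
    rw [← h1]
    exact Finset.single_le_sum (f := fun j : Fin m => driftEntry q g A w.1 j (w.2.2 j).1)
      (fun _ _ => zero_le) (Finset.mem_univ i)
  -- A flag at a gap of at most `g` shows in the second term of the excess.
  · refine Or.inl (Or.inr ?_)
    refine le_trans ?_ (le_iSup (fun j => excess q ζ t w.1 (w.2.2 j)) i)
    rw [excess, hi]
    simp only [isAnswer, isFlagged, Sum.elim_inl, if_true]
    refine le_max_of_le_right (ENNReal.ofReal_le_ofReal ?_)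
    linarith [not_lt.1 hg]

/-- The probability of failure, split into its three causes. -/
lemma measureReal_compl_goodEvent_le (hn : 0 < n) (hq : Measurable (Function.uncurry q))
    (hq1 : ∀ θ x, q θ x ∈ Set.Icc (0 : ℝ) 1) {ζ B σ t τ g : ℝ} (hσ : 0 < σ) (ht : 0 ≤ t)
    (hg : 0 ≤ g) (hgt : 0 < ζ - 2 * g - 6 * t) (A : Analyst X Θ n) (m : ℕ) :
    (law D q ζ B σ A m).real (goodEvent D q τ A m)ᶜ
      ≤ (law D q ζ B σ A m).real {w | w.2.2 ∈ badRecord D q τ m}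
        + (m + 1) * (7 * σ * Real.exp (-t / σ)) / (ζ - 2 * g - 6 * t)
        + m * (4 * Real.exp (-2 * n * g ^ 2)) := by
  have hprob := isProbabilityMeasure_law (D := D) hq ζ B hσ A m
  set P := law D q ζ B σ A m with hP
  have hmE : Measurable fun w : Data X n × Config Θ m => maxExcess q ζ t w.1 w.2.2 := by
    have h := (measurable_maxExcess hq ζ t m (n := n)).comp
      (measurable_fst.prodMk (measurable_snd.comp measurable_snd) :
        Measurable fun w : Data X n × Config Θ m => (w.1, w.2.2))
    exact h
  have hmD : Measurable fun w : Data X n × Config Θ m => drift q (2 * g) A w.1 w.2.2 := by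
    have h := (measurable_drift hq (2 * g) A m).comp
      (measurable_fst.prodMk (measurable_snd.comp measurable_snd) :
        Measurable fun w : Data X n × Config Θ m => (w.1, w.2.2))
    exact h
  have hE : P {w | ENNReal.ofReal (ζ - 2 * g - 6 * t) ≤ maxExcess q ζ t w.1 w.2.2}
      ≤ ENNReal.ofReal ((m + 1) * (7 * σ * Real.exp (-t / σ)) / (ζ - 2 * g - 6 * t)) := by
    rw [ENNReal.ofReal_div_of_pos hgt]
    refine (meas_ge_le_lintegral_div hmE.aemeasurable (ENNReal.ofReal_pos.2 hgt).ne'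
      ENNReal.ofReal_ne_top).trans ?_
    gcongr
    exact lintegral_maxExcess_law_le hq ζ B hσ ht A m
  have hD : P {w | 1 ≤ drift q (2 * g) A w.1 w.2.2}
      ≤ ENNReal.ofReal (m * (4 * Real.exp (-2 * n * g ^ 2))) := by
    refine (meas_ge_le_lintegral_div hmD.aemeasurable one_ne_zero ENNReal.one_ne_top).trans ?_
    rw [div_one]
    refine (lintegral_drift_le hn hq hq1 ζ B hσ A hg m).trans_eq ?_
    rw [ENNReal.ofReal_mul (by positivity), ENNReal.ofReal_mul (by positivity),
      ENNReal.ofReal_natCast, ENNReal.ofReal_ofNat]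
  refine (measureReal_mono (compl_goodEvent_subset (ζ := ζ) (t := t) (g := 2 * g) A m)).trans
    ((measureReal_union_le _ _).trans (add_le_add ((measureReal_union_le _ _).trans
      (add_le_add le_rfl ?_)) ?_))
  · exact ENNReal.toReal_le_of_le_ofReal (by positivity) hE
  · exact ENNReal.toReal_le_of_le_ofReal (by positivity) hD

/-- Above the cutoff `δ`, `u^a ≤ δ^(a-1) u`, so `C u^a` exceeds `u` by at most `μ u / 8 ≤ μ p / 8`,
which the left side absorbs. Below the cutoff, `C u^a ≤ 2δ`. -/
lemma mul_le_of_moment_bound {p u μ N C a δ : ℝ} (hu : 0 ≤ u) (hup : u ≤ p) (hμ : 0 ≤ μ)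
    (hδ : 0 < δ) (ha : 0 < a) (ha1 : a ≤ 1) (hC : 0 ≤ C) (hC1 : C * δ ^ (a - 1) ≤ 1 + μ / 8)
    (hC2 : C * δ ^ (a - 1) ≤ 2) (hN : 0 ≤ N) (h : u + μ * p ≤ C * u ^ a + N) :
    7 / 8 * μ * p ≤ N + 2 * δ := by
  have hp : 0 ≤ p := hu.trans hup
  have hμp : 0 ≤ μ * p := mul_nonneg hμ hp
  rcases le_or_gt u δ with hle | hlt
  · have h1 : u ^ a ≤ δ ^ (a - 1) * δ := by
      refine (Real.rpow_le_rpow hu hle ha.le).trans_eq ?_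
      rw [← Real.rpow_add_one hδ.ne']; congr 1; ring
    have h2 : C * u ^ a ≤ 2 * δ := by
      refine (mul_le_mul_of_nonneg_left h1 hC).trans ?_
      rw [← mul_assoc]
      exact mul_le_mul_of_nonneg_right hC2 hδ.le
    linarith
  · have hu0 : 0 < u := hδ.trans hlt
    have h1 : u ^ a ≤ δ ^ (a - 1) * u := by
      have h3 : u ^ a = u ^ (a - 1) * u := by
        rw [← Real.rpow_add_one hu0.ne']; congr 1; ring
      rw [h3]
      exact mul_le_mul_of_nonneg_right
        (Real.rpow_le_rpow_of_nonpos hδ hlt.le (by linarith)) hu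
    have h2 : C * u ^ a ≤ (1 + μ / 8) * u := by
      refine (mul_le_mul_of_nonneg_left h1 hC).trans ?_
      rw [← mul_assoc]
      exact mul_le_mul_of_nonneg_right hC1 hu
    have h4 : μ * u ≤ μ * p := mul_le_mul_of_nonneg_left hup hμ
    linarith

end Assembly

/-! ### Numerical choice of the exponent and of the sample size. -/

section Numerics

/-- As `log (4/τ₀) ≥ log 4 > 1`, the iterated logarithm keeps the whole expression above `1/4` even
when `β τ₀` is near 1. Then `32/4 ≥ log 1000` absorbs the constant of the cutoff `δ = β τ₀ / 1000`.
-/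
lemma one_fourth_le_log_log {β τ₀ : ℝ} (hβ : 0 < β) (hβ1 : β < 1) (hτ : 0 < τ₀) (hτ1 : τ₀ ≤ 1) :
    1 / 4 ≤ Real.log (Real.log (4 / τ₀) / (β * τ₀)) ∧
      Real.log (1 / (β * τ₀ / 1000)) ≤ 32 * Real.log (Real.log (4 / τ₀) / (β * τ₀)) := by
  have hβτ : 0 < β * τ₀ := mul_pos hβ hτ
  have hlog4 : 1.386 ≤ Real.log 4 := by
    have : Real.log 4 = 2 * Real.log 2 := by
      rw [show (4 : ℝ) = 2 ^ 2 by norm_num, Real.log_pow]; norm_num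
    rw [this]; linarith [Real.log_two_gt_d9]
  have h4 : 1.386 ≤ Real.log (4 / τ₀) :=
    hlog4.trans (Real.log_le_log (by norm_num) (by rw [le_div_iff₀ hτ]; linarith))
  have hll : 1 / 4 ≤ Real.log (Real.log (4 / τ₀)) := by
    have h1 := Real.one_sub_inv_le_log_of_pos (by linarith : 0 < Real.log (4 / τ₀))
    have h2 : (Real.log (4 / τ₀))⁻¹ ≤ 3 / 4 := by
      rw [inv_le_comm₀ (by linarith) (by norm_num)]; norm_num; linarith
    linarith
  have hinv : 0 ≤ Real.log (1 / (β * τ₀)) :=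
    Real.log_nonneg (by rw [le_div_iff₀ hβτ]; nlinarith)
  have hΛ : Real.log (Real.log (4 / τ₀) / (β * τ₀))
      = Real.log (Real.log (4 / τ₀)) + Real.log (1 / (β * τ₀)) := by
    rw [← Real.log_mul (by linarith) (by positivity)]; congr 1; ring
  have h1000 : Real.log 1000 ≤ 7 := by
    have : Real.log 1000 ≤ Real.log 1024 := Real.log_le_log (by norm_num) (by norm_num)
    have h2 : Real.log 1024 = 10 * Real.log 2 := by
      rw [show (1024 : ℝ) = 2 ^ 10 by norm_num, Real.log_pow]; norm_num
    linarith [Real.log_two_lt_d9]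
  have hδ : Real.log (1 / (β * τ₀ / 1000)) = Real.log 1000 + Real.log (1 / (β * τ₀)) := by
    rw [← Real.log_mul (by norm_num) (by positivity)]; congr 1; field_simp
  rw [hΛ, hδ]
  constructor <;> linarith

lemma exp_le_one_add_two_mul {x : ℝ} (hx : 0 ≤ x) (hx1 : x ≤ 1) : Real.exp x ≤ 1 + 2 * x := by
  have h := Real.abs_exp_sub_one_le (x := x) (by rwa [abs_of_nonneg hx])
  rw [abs_of_nonneg hx] at h
  linarith [le_abs_self (Real.exp x - 1)]

variable {X : Type u} {Θ : Type v} [MeasurableSpace X] [MeasurableSpace Θ] {n : ℕ}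
  {q : Θ → X → ℝ}

/-- The sample size makes Thresholdout stable: through pure privacy in the first regime, through
the moment bound in the second. -/
lemma exists_isStable (hn : 0 < n) (hq : Measurable (Function.uncurry q))
    (hq1 : ∀ θ x, q θ x ∈ Set.Icc (0 : ℝ) 1) {β τ B L Λ : ℝ} {m : ℕ} (hβ : 0 < β) (hβ1 : β < 1)
    (hτ : 0 < τ) (hτ64 : τ ≤ 64) (hB : 1 ≤ B) (hL : 1 ≤ L)
    (hΛ : Λ = Real.log (Real.log (4 / min τ 1) / (β * min τ 1)))
    (hsize : min (2 ^ 20 * (B * L / τ ^ 2)) (2 ^ 29 * (L * √(B * Λ) / τ ^ 2)) ≤ (n : ℝ)) (ζ : ℝ)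
    (A : Analyst X Θ n) :
    ∃ a C : ℝ, 0 < a ∧ a ≤ 1 ∧ 0 ≤ C ∧ IsStable q ζ B (τ / (48 * L)) A m a (ENNReal.ofReal C) ∧
      C * (β * min τ 1 / 1000) ^ (a - 1) ≤ 1 + min τ 1 / 64 := by
  set τ₀ := min τ 1 with hτ₀
  have hτ₀0 : 0 < τ₀ := lt_min hτ one_pos
  have hτ₀1 : τ₀ ≤ 1 := min_le_right _ _
  have hττ₀ : τ ≤ 64 * τ₀ := by
    rcases min_cases τ 1 with ⟨h, _⟩ | ⟨h, _⟩ <;> rw [← hτ₀] at h <;> linarith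
  obtain ⟨hΛ4, hδΛ⟩ := one_fourth_le_log_log hβ hβ1 hτ₀0 hτ₀1
  rw [← hΛ] at hΛ4 hδΛ
  set δ := β * τ₀ / 1000 with hδ
  have hδ0 : 0 < δ := by positivity
  have hn' : (0 : ℝ) < n := by exact_mod_cast hn
  have hB0 : 0 < B := by linarith
  have hL0 : 0 < L := by linarith
  have hΛ0 : 0 < Λ := by linarith
  have hσ : 0 < τ / (48 * L) := by positivity
  have hfin : ∀ x : ℝ, x ≤ τ₀ / 128 → Real.exp x ≤ 1 + τ₀ / 64 := fun x hx =>
    (Real.exp_le_exp.2 hx).trans ((exp_le_one_add_two_mul (by positivity) (by linarith)).trans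
      (by linarith))
  set v := 2 * (1 / (n : ℝ) / (τ / (48 * L))) with hv
  have hv0 : 0 < v := by positivity
  have hvτ : v * (n * τ) = 96 * L := by rw [hv]; field_simp; ring
  have hfloor : (⌊B⌋₊ : ℝ) ≤ B := Nat.floor_le hB0.le
  have hpure : B * v ≤ τ₀ / 128 → ∃ a C : ℝ, 0 < a ∧ a ≤ 1 ∧ 0 ≤ C ∧
      IsStable q ζ B (τ / (48 * L)) A m a (ENNReal.ofReal C) ∧
      C * δ ^ (a - 1) ≤ 1 + τ₀ / 64 := by
    intro hBv
    refine ⟨1, Real.exp v ^ ⌊B⌋₊, one_pos, le_rfl, by positivity, ?_, ?_⟩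
    · rw [ENNReal.ofReal_pow (Real.exp_pos _).le]
      exact isStable_one hq hq1 ζ B hσ A m
    · rw [sub_self, Real.rpow_zero, mul_one, ← Real.exp_nat_mul]
      exact hfin _ ((mul_le_mul_of_nonneg_right hfloor hv0.le).trans hBv)
  rcases min_le_iff.1 hsize with h1 | h2
  · refine hpure ?_
    have h3 : 2 ^ 20 * (B * L) ≤ n * τ ^ 2 := by
      rwa [mul_div_assoc', div_le_iff₀ (by positivity)] at h1
    have h4 : v * (2 ^ 20 * (B * L)) ≤ 96 * L * τ := by
      rw [← hvτ]
      refine (mul_le_mul_of_nonneg_left h3 hv0.le).trans_eq (by ring)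
    have h5 : 2 ^ 20 * (B * v) ≤ 96 * τ := by
      refine le_of_mul_le_mul_right ?_ hL0
      linarith
    linarith
  · set W := √(B * Λ) with hW
    have hW2 : W ^ 2 = B * Λ := Real.sq_sqrt (by positivity)
    have hW0 : 0 < W := Real.sqrt_pos.2 (by positivity)
    have h3 : 2 ^ 29 * (L * W) ≤ n * τ ^ 2 := by
      rwa [mul_div_assoc', div_le_iff₀ (by positivity)] at h2
    have h4 : v * (2 ^ 29 * (L * W)) ≤ 96 * L * τ := by
      rw [← hvτ]
      refine (mul_le_mul_of_nonneg_left h3 hv0.le).trans_eq (by ring)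
    have h5 : 2 ^ 29 * (v * W) ≤ 96 * τ := by
      refine le_of_mul_le_mul_right ?_ hL0
      linarith
    have h6 : v * W ≤ 3 / 2 ^ 18 * τ₀ := by linarith
    -- For `B < Λ` one has `B ≤ √(BΛ)`, and pure composition suffices. Otherwise `Λ ≤ √(BΛ)`, which
    -- makes `v` small against `r`, as the moment bound requires.
    rcases lt_or_ge B Λ with hBΛ | hBΛ
    · refine hpure ?_
      have hBW : B ≤ W := by
        rw [hW]; exact Real.le_sqrt_of_sq_le (by nlinarith)
      have := mul_le_mul_of_nonneg_left hBW hv0.le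
      linarith
    have hΛW : Λ ≤ W := by
      rw [hW]; exact Real.le_sqrt_of_sq_le (by nlinarith)
    have hvΛ : v * Λ ≤ 3 / 2 ^ 18 * τ₀ := (mul_le_mul_of_nonneg_left hΛW hv0.le).trans h6
    -- Here `s = 1 + r`. The cutoff factor is at most `exp (32 Λ r)`, which asks for `r` of order at
    -- most `τ₀/Λ`; the composed constant, at most `exp (136 B v² / r)`, favours a large `r`.
    set r := τ₀ / (2 ^ 13 * Λ) with hr
    have hr0 : 0 < r := by positivity
    have hrΛ : r * Λ = τ₀ / 2 ^ 13 := by rw [hr]; field_simp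
    have hr1 : r ≤ 1 := by
      rw [hr, div_le_one (by positivity)]; linarith
    have hvr : v ≤ r / 8 := by
      refine le_of_mul_le_mul_right ?_ hΛ0
      rw [div_mul_eq_mul_div, hrΛ]
      linarith
    have hη : Real.exp v - 1 ≤ 2 * v := by
      linarith [exp_le_one_add_two_mul hv0.le (by linarith)]
    have hη0 : 0 ≤ Real.exp v - 1 := by linarith [Real.add_one_le_exp v]
    have hs : 1 < 1 + r := by linarith
    set y := 17 * (1 + r) * (Real.exp v - 1) ^ 2 / (1 + r - 1) with hy
    have hrr : 1 + r - 1 = r := by ring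
    have hy0 : 0 ≤ y := by rw [hy, hrr]; positivity
    have hyB : B * y ≤ τ₀ / 256 := by
      have e1 : (Real.exp v - 1) ^ 2 ≤ 4 * v ^ 2 :=
        (pow_le_pow_left₀ hη0 hη 2).trans_eq (by ring)
      have e2 : y ≤ 136 * v ^ 2 / r := by
        rw [hy, hrr]
        refine div_le_div_of_nonneg_right ?_ hr0.le
        calc 17 * (1 + r) * (Real.exp v - 1) ^ 2 ≤ 34 * (4 * v ^ 2) :=
              mul_le_mul (by linarith) e1 (sq_nonneg _) (by norm_num)
          _ = 136 * v ^ 2 := by ring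
      have e3 : (v * W) ^ 2 ≤ (3 / 2 ^ 18 * τ₀) ^ 2 := by gcongr
      rw [mul_pow, hW2] at e3
      have e4 : B * (136 * v ^ 2 / r) = 136 * 2 ^ 13 * (v ^ 2 * (B * Λ)) / τ₀ := by
        rw [hr]; field_simp
      refine (mul_le_mul_of_nonneg_left e2 hB0.le).trans ?_
      rw [e4, div_le_iff₀ hτ₀0]
      linarith [sq_nonneg τ₀]
    refine ⟨(1 + r)⁻¹, (1 + y) ^ ⌊B⌋₊, by positivity, inv_le_one_of_one_le₀ hs.le, by positivity,
      ?_, ?_⟩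
    · rw [ENNReal.ofReal_pow (by positivity)]
      refine isStable_moment hq hq1 ζ B hσ hs ?_ A m
      rw [hrr, le_div_iff₀ (by positivity)]
      calc (Real.exp v - 1) * (2 * (1 + r)) ≤ r / 4 * 4 :=
            mul_le_mul (by linarith) (by linarith) (by positivity) (by positivity)
        _ = r := by ring
    · have e1 : (1 + y) ^ ⌊B⌋₊ ≤ Real.exp (B * y) := by
        calc (1 + y) ^ ⌊B⌋₊ ≤ Real.exp y ^ ⌊B⌋₊ := by
              gcongr; linarith [Real.add_one_le_exp y]
          _ = Real.exp (⌊B⌋₊ * y) := (Real.exp_nat_mul _ _).symm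
          _ ≤ _ := Real.exp_le_exp.2 (mul_le_mul_of_nonneg_right hfloor hy0)
      have e2 : δ ^ ((1 + r)⁻¹ - 1) ≤ Real.exp (τ₀ / 256) := by
        rw [Real.rpow_def_of_pos hδ0]
        refine Real.exp_le_exp.2 ?_
        have hl : Real.log δ = -Real.log (1 / δ) := by rw [one_div, Real.log_inv, neg_neg]
        have h1r : 1 - (1 + r)⁻¹ ≤ r := by
          have : 1 - (1 + r)⁻¹ = r / (1 + r) := by field_simp; ring
          rw [this]; exact div_le_self hr0.le (by linarith)
        have h1r0 : 0 ≤ 1 - (1 + r)⁻¹ := sub_nonneg.2 (inv_le_one_of_one_le₀ hs.le)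
        calc Real.log δ * ((1 + r)⁻¹ - 1) = Real.log (1 / δ) * (1 - (1 + r)⁻¹) := by
              rw [hl]; ring
          _ ≤ 32 * Λ * r := mul_le_mul hδΛ h1r h1r0 (by positivity)
          _ = 32 * (r * Λ) := by ring
          _ = τ₀ / 256 := by rw [hrΛ]; ring
      calc _ ≤ Real.exp (B * y) * Real.exp (τ₀ / 256) := by gcongr
        _ = Real.exp (B * y + τ₀ / 256) := (Real.exp_add _ _).symm
        _ ≤ _ := hfin _ (by linarith)

/-- Both regimes provide enough samples for uniform convergence on a fixed query. -/
lemma sample_size_ge {τ B L Λ : ℝ} (hτ : 0 < τ) (hB : 1 ≤ B) (hL : 1 ≤ L) (hΛ : 1 / 4 ≤ Λ)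
    (hsize : min (2 ^ 20 * (B * L / τ ^ 2)) (2 ^ 29 * (L * √(B * Λ) / τ ^ 2)) ≤ (n : ℝ)) :
    1536 * L ≤ n * τ ^ 2 := by
  have hL0 : 0 < L := by linarith
  rcases min_le_iff.1 hsize with h | h <;>
    rw [mul_div_assoc', div_le_iff₀ (by positivity)] at h
  · nlinarith
  · have : 1 / 2 ≤ √(B * Λ) := Real.le_sqrt_of_sq_le (by nlinarith)
    nlinarith

end Numerics

/-! ### The case of a budget below one, and the final estimate. -/

section Main

variable {X : Type u} {Θ : Type v} [MeasurableSpace X] [MeasurableSpace Θ] {n : ℕ}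
  {D : Measure X} [IsProbabilityMeasure D] {q : Θ → X → ℝ}

/-- The records with an answered round. -/
def answeredRecord (Θ : Type v) (i : ℕ) : Set (History Θ i) :=
  {h | ∃ j, isAnswer (h j).2 = true}

lemma measurableSet_answeredRecord (i : ℕ) : MeasurableSet (answeredRecord Θ i) := by
  have : answeredRecord Θ i = ⋃ j, (fun h : History Θ i => isAnswer (h j).2) ⁻¹' {true} := by
    ext; simp [answeredRecord]
  rw [this]
  exact MeasurableSet.iUnion fun j => (measurable_isAnswer.comp
    (measurable_snd.comp (measurable_pi_apply j))) (measurableSet_singleton true)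

lemma haltVal_answeredRecord (κ : ∀ i, Kernel (History Θ i) Θ) (j i : ℕ) (h : History Θ i)
    (hh : h ∉ answeredRecord Θ i) :
    haltVal κ (fun i => (answeredRecord Θ i).indicator 1) j i h = 0 := by
  induction j generalizing i with
  | zero => exact Set.indicator_of_notMem hh _
  | succ j ih =>
    rw [haltVal]
    refine lintegral_eq_zero_of_ae_eq_zero (ae_of_all _ fun θ => ih _ _ ?_)
    rintro ⟨k, hk⟩
    revert hk
    refine Fin.lastCases (fun hk => ?_) (fun k hk => hh ⟨k, ?_⟩) k
    · simp [isAnswer] at hk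
    · simpa using hk

/-- With a budget below one, no query is answered. -/
lemma law_compl_goodEvent_of_lt_one (hq : Measurable (Function.uncurry q)) (ζ τ : ℝ) {B σ : ℝ}
    (hσ : 0 < σ) (hB : B < 1) (A : Analyst X Θ n) (m : ℕ) :
    law D q ζ B σ A m (goodEvent D q τ A m)ᶜ = 0 := by
  have hms := measurableSet_answeredRecord (Θ := Θ) m
  have hsub : (goodEvent D q τ A m)ᶜ
      ⊆ {w : Data X n × Config Θ m | w.2.2 ∈ answeredRecord Θ m} := by
    intro w hw
    by_contra hcon
    refine hw fun i a o hi => (hcon ⟨i, ?_⟩).elim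
    rw [hi]; rfl
  refine measure_mono_null hsub ?_
  have hm2 : MeasurableSet {w : Data X n × Config Θ m | w.2.2 ∈ answeredRecord Θ m} :=
    (measurable_snd.comp measurable_snd) hms
  rw [← lintegral_indicator_one hm2, lintegral_law hq ζ B hσ A m (measurable_one.indicator hm2)]
  refine lintegral_eq_zero_of_ae_eq_zero (ae_of_all _ fun d => ?_)
  have h := lintegral_run_eq_budgetVal (ζ := ζ) (A := A) hq hσ
    (F := fun i => (answeredRecord Θ i).indicator 1)
    (fun i => measurable_one.indicator (measurableSet_answeredRecord i)) B d m
  rw [Nat.floor_eq_zero.2 hB] at h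
  refine Eq.trans (lintegral_congr fun c => ?_)
    (h.trans (haltVal_answeredRecord _ m 0 _ fun ⟨k, _⟩ => k.elim0))
  rfl

lemma measureReal_compl_goodEvent_le_beta (hq : Measurable (Function.uncurry q))
    (hq1 : ∀ θ x, q θ x ∈ Set.Icc (0 : ℝ) 1) {β τ B : ℝ} {m : ℕ} (hβ : 0 < β) (hβ1 : β < 1)
    (hτ : 0 < τ) (hB : 1 ≤ B) (hBm : B ≤ m)
    (hsize : min (2 ^ 20 * (B * Real.log (4 * m / β) / τ ^ 2))
      (2 ^ 29 * (Real.log (4 * m / β) *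
        √(B * Real.log (Real.log (4 / min τ 1) / (β * min τ 1))) / τ ^ 2)) ≤ (n : ℝ))
    (A : Analyst X Θ n) :
    (law D q (3 * τ / 4) B (τ / (48 * Real.log (4 * m / β))) A m).real (goodEvent D q τ A m)ᶜ
      ≤ β := by
  have hm1 : (1 : ℝ) ≤ m := hB.trans hBm
  have hm0 : (0 : ℝ) < m := by linarith
  have h4m : 4 ≤ 4 * m / β := by rw [le_div_iff₀ hβ]; nlinarith
  set L := Real.log (4 * m / β) with hLdef
  have hL : 1 ≤ L := by
    rw [hLdef, Real.le_log_iff_exp_le (by linarith)]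
    linarith [Real.exp_one_lt_d9]
  have hexpL : Real.exp (-L) = β / (4 * m) := by
    rw [Real.exp_neg, hLdef, Real.exp_log (by linarith), inv_div]
  have hL0 : 0 < L := by linarith
  set τ₀ := min τ 1 with hτ₀
  have hτ₀0 : 0 < τ₀ := lt_min hτ one_pos
  have hτ₀τ : τ₀ ≤ τ := min_le_left _ _
  have hτ₀1 : τ₀ ≤ 1 := min_le_right _ _
  have hsz := sample_size_ge hτ hB hL (one_fourth_le_log_log hβ hβ1 hτ₀0 hτ₀1).1 hsize
  have hn : 0 < n := by
    rcases Nat.eq_zero_or_pos n with h | h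
    · rw [h] at hsz; simp only [Nat.cast_zero, zero_mul] at hsz; linarith
    · exact h
  set σ := τ / (48 * L) with hσdef
  have hσ : 0 < σ := by positivity
  have hσle : σ ≤ τ / 48 := by
    rw [hσdef]; exact div_le_div_of_nonneg_left hτ.le (by norm_num) (by linarith)
  -- The allowance `t = τ/48` gives `t/σ = L`, so each noise tail is exactly `β/(4m)`.
  have hexp : Real.exp (-(τ / 48) / σ) = β / (4 * m) := by
    rw [← hexpL, hσdef]; congr 1; field_simp
  have hN : (m + 1) * (7 * σ * Real.exp (-(τ / 48) / σ)) ≤ 7 / 96 * (τ * β) := by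
    rw [hexp]
    calc (m + 1) * (7 * σ * (β / (4 * m))) ≤ (2 * m) * (7 * (τ / 48) * (β / (4 * m))) := by
          gcongr; linarith
      _ = 7 / 96 * (τ * β) := by field_simp; ring
  have hN0 : 0 ≤ (m + 1) * (7 * σ * Real.exp (-(τ / 48) / σ)) := by positivity
  set p := (law D q (3 * τ / 4) B σ A m).real {w | w.2.2 ∈ badRecord D q τ m} with hp
  have hp0 : 0 ≤ p := measureReal_nonneg
  have hbadp : 7 / 8 * (τ / 8) * p ≤ 7 / 96 * (τ * β) + 2 * (β * τ₀ / 1000) := by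
    have hμ : τ - 3 * τ / 4 - 6 * (τ / 48) = τ / 8 := by ring
    rcases le_or_gt τ 64 with h64 | h64
    · obtain ⟨a, C, ha, ha1, hC, hst, hCδ⟩ :=
        exists_isStable hn hq hq1 (m := m) hβ hβ1 hτ h64 hB hL rfl hsize (3 * τ / 4) A
      obtain ⟨u, hu, hup, h1, -⟩ := exists_score_mean_bounds (D := D) (t := τ / 48) (τ := τ) hn hq
        hq1 hσ (by positivity) (by linarith) (by positivity) A m ha ha1 hC hst
      rw [hμ] at h1
      have := mul_le_of_moment_bound hu hup (by positivity) (by positivity) ha ha1 hC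
        (hCδ.trans (by linarith)) (hCδ.trans (by linarith)) hN0 h1
      linarith
    -- For `τ > 64` the gap `τ/8` dwarfs the score, which is at most 1; the bound `(τ/8) p ≤ p + N`
    -- suffices.
    · have hst : IsStable q (3 * τ / 4) B σ A m 1
          (ENNReal.ofReal (Real.exp (2 * (1 / n / σ)) ^ ⌊B⌋₊)) := by
        rw [ENNReal.ofReal_pow (Real.exp_pos _).le]
        exact isStable_one hq hq1 _ B hσ A m
      obtain ⟨u, -, -, -, h2⟩ := exists_score_mean_bounds (D := D) (t := τ / 48) (τ := τ) hn hq
        hq1 hσ (by positivity) (by linarith) (by positivity) A m one_pos le_rfl (by positivity) hst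
      rw [hμ] at h2
      have h3 : p ≤ τ / 64 * p := le_mul_of_one_le_left hp0 (by linarith)
      have : 0 ≤ 2 * (β * τ₀ / 1000) := by positivity
      linarith
  have hpβ : p ≤ 7 / 10 * β := by
    have h1 : β * τ₀ ≤ β * τ := mul_le_mul_of_nonneg_left hτ₀τ hβ.le
    have h2 : τ * p ≤ τ * (7 / 10 * β) := by linarith [mul_pos hτ hβ]
    exact le_of_mul_le_mul_left h2 hτ
  have hmarkov : (m + 1) * (7 * σ * Real.exp (-(τ / 48) / σ))
      / (3 * τ / 4 - 2 * (τ / 32) - 6 * (τ / 48)) ≤ 13 / 100 * β := by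
    rw [div_le_iff₀ (by linarith)]
    linarith [mul_pos hτ hβ]
  -- The Hoeffding exponent is `n τ² / 512 ≥ 3L`: one factor `exp (-L)` pays for the `m` rounds, the
  -- other two are at most `1/4` each.
  have hdrift : m * (4 * Real.exp (-2 * n * (τ / 32) ^ 2)) ≤ 1 / 16 * β := by
    have h1 : Real.exp (-2 * n * (τ / 32) ^ 2)
        ≤ Real.exp (-L) * (Real.exp (-L) * Real.exp (-L)) := by
      rw [← Real.exp_add, ← Real.exp_add]
      refine Real.exp_le_exp.2 ?_
      linarith
    have h2 : Real.exp (-L) ≤ 1 / 4 := by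
      rw [hexpL, div_le_div_iff₀ (by positivity) (by norm_num)]; linarith
    have h3 : Real.exp (-L) * Real.exp (-L) ≤ 1 / 4 * (1 / 4) := by gcongr
    calc m * (4 * Real.exp (-2 * n * (τ / 32) ^ 2))
        ≤ m * (4 * (Real.exp (-L) * (1 / 4 * (1 / 4)))) := by
          gcongr
          exact h1.trans (mul_le_mul_of_nonneg_left h3 (Real.exp_pos _).le)
      _ = 1 / 16 * β := by rw [hexpL]; field_simp; ring
  refine (measureReal_compl_goodEvent_le (t := τ / 48) (g := τ / 32) hn hq hq1 hσ (by positivity)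
    (by positivity) (by linarith) A m).trans ?_
  linarith

end Main

end Thresholdout

theorem mainTheorem8 :
    ∃ C₁ C₂ : ℝ, 0 < C₁ ∧ 0 < C₂ ∧
      ∀ (X : Type u) [MeasurableSpace X] (D : Measure X) [IsProbabilityMeasure D]
        (Θ : Type v) [MeasurableSpace Θ] (q : Θ → X → ℝ),
        Measurable (Function.uncurry q) → (∀ θ x, q θ x ∈ Set.Icc (0 : ℝ) 1) →
      ∀ (β τ B : ℝ) (m n : ℕ), 0 < β → 0 < τ → 0 < B → B ≤ m →
        min (C₁ * (B * Real.log (4 * m / β) / τ ^ 2))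
            (C₂ * (Real.log (4 * m / β) *
              √(B * Real.log (Real.log (4 / min τ 1) / (β * min τ 1))) / τ ^ 2)) ≤ n →
      ∀ A : Analyst X Θ n,
        1 - β ≤ (law D q (3 * τ / 4) B (τ / (48 * Real.log (4 * m / β))) A m).real
          (goodEvent D q τ A m) := by
  -- `2 ^ 20 ≥ 96 * 64 * 128` ensures `B v ≤ τ₀/128` in `exists_isStable`. `2 ^ 29` gives `v Λ ≤ 3
  -- τ₀ / 2 ^ 18` when `Λ ≤ B`, just below the `τ₀ / 2 ^ 16` needed for `v ≤ r / 8`.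
  refine ⟨2 ^ 20, 2 ^ 29, by norm_num, by norm_num, ?_⟩
  intro X _ D _ Θ _ q hq hq1 β τ B m n hβ hτ hB0 hBm hsize A
  rcases le_or_gt 1 β with hβ1 | hβ1
  · exact (sub_nonpos.2 hβ1).trans measureReal_nonneg
  have hm1 : (1 : ℝ) ≤ m := by
    have : 0 < m := by exact_mod_cast hB0.trans_le hBm
    exact_mod_cast this
  have hL : 0 < Real.log (4 * m / β) :=
    Real.log_pos (by rw [lt_div_iff₀ hβ]; linarith)
  have hσ : 0 < τ / (48 * Real.log (4 * m / β)) := by positivity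
  have hcompl : (law D q (3 * τ / 4) B (τ / (48 * Real.log (4 * m / β))) A m).real
      (goodEvent D q τ A m)ᶜ ≤ β := by
    rcases lt_or_ge B 1 with hB | hB
    · rw [measureReal_def, law_compl_goodEvent_of_lt_one hq _ τ hσ hB A m]
      exact hβ.le
    · exact measureReal_compl_goodEvent_le_beta hq hq1 hβ hβ1 hτ hB hBm hsize A
  have hprob := isProbabilityMeasure_law (D := D) hq (3 * τ / 4) B hσ A m
  -- Subadditivity bounds the good event from below without its measurability.
  have huniv := measureReal_union_le
    (μ := law D q (3 * τ / 4) B (τ / (48 * Real.log (4 * m / β))) A m)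
    (goodEvent D q τ A m) (goodEvent D q τ A m)ᶜ
  rw [Set.union_compl_self, probReal_univ] at huniv
  linarith
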